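/- **Definitions.** Let $\mathbb{B}=\{0,1\}$ and consider functions $f:\mathbb{B}^I\to\mathbb{R}$. A *decision tree* branches on single components $x_i$ and has real leaves; its size is its number of nodes. An *algebraic decision diagram* (ADD) is a rooted diagram with real terminals and shared decision nodes, each testing one component $x_i$, in which along every path the components are inspected (possibly skipping some) in one common, arbitrary order; its size is its number of nodes. A *rule system* is a finite family of rules $\bigwedge_{(i,v)\in A_r}(x_i=v)\Rightarrow f(x)=c_r$ such that every $x\in\mathbb{B}^I$ satisfies exactly one antecedent; its size is $\sum_r(1+|A_r|)$. An *MILP-based feature representation* of $f$ consists of a feature map $\phi:\mathbb{B}^I\to\mathbb{B}^F$ and a function $\rho:\mathbb{B}^F\to\mathbb{R}$ depending only on the features in a set $J\subseteq\{1,\dots,F\}$ such that $f=\rho\circ\phi$, together with a system of $F_c$ linear inequalities with integer data defining a polyhedron $\mathcal{F}$ such that for all $x\in\mathbb{B}^I$, $\varphi\in\mathbb{B}^F$ $$\phi(x)=\varphi\iff(\varphi,\zeta;x)\in\mathcal{F}\text{ for some }\zeta\in\mathbb{R}^{F_l}\times\mathbb{B}^{F_b}.$$ Its size is $F+F_l+F_b+F_c$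 plus the total bit length of the coefficients and right-hand sides of the system ($0$ having bit length $0$) plus the number $2^{|J|}$ of entries of the table of values of $\rho$. **Theorem.** (i) There is a polynomial $p$ such that for every $I$ and every $f:\mathbb{B}^I\to\mathbb{R}$, any decision tree, ADD or rule system of size $s$ that represents $f$ has an equivalent MILP-based feature representation of size at most $p(s)$. (ii) There are a constant $\delta>0$ and MILP-based feature representations of arbitrarily large size $s$ such that every equivalent decision tree, every equivalent ADD and every equivalent rule system has size at least $2^{\delta s}$. In particular: - *Parity.* There is a constant $C$ such that for all $I\ge1$ the function with value $1$ if $\sum_i x_i$ is even and $0$ otherwise on $\mathbb{B}^I$ has an MILP-based feature representation of size at most $CI$, whereas every decision tree and every rule system that represents it has size at least $2^I$. - *Binary multiplication.* There are constants $C$ and $\delta>0$ such that for all $I\ge1$ each of the $2I$ bits of the product of two $I$-bit numbers, as a function on $\mathbb{B}^{2I}$, has an MILP-based feature representation of size at most $CI$, whereas every ADD that represents the bit of weight $2^{I-1}$ has size at least $2^{\delta I}$. -/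

import Mathlib

noncomputable section

namespace CSI

/-- The binary vectors `𝔹^I`. -/
abbrev BVec (I : ℕ) : Type := Fin I → Bool

/-! ### Decision trees -/

/-- Decision trees over the variables `x_i`, `i : Fin I`, with real leaves.  The first subtree
of `branch i` is followed if `x_i = 1` and the second one if `x_i = 0`. -/
inductive DecisionTree (I : ℕ) : Type
  | leaf (c : ℝ) : DecisionTree I
  | branch (i : Fin I) (hi lo : DecisionTree I) : DecisionTree I

namespace DecisionTree

variable {I : ℕ}

def eval : DecisionTree I → BVec I → ℝ
  | leaf c, _ => c
  | branch i hi lo, x => if x i = true then hi.eval x else lo.eval x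

/-- The number of nodes (inner nodes and leaves). -/
def size : DecisionTree I → ℕ
  | leaf _ => 1
  | branch _ hi lo => hi.size + lo.size + 1

def Represents (t : DecisionTree I) (f : BVec I → ℝ) : Prop :=
  ∀ x, t.eval x = f x

end DecisionTree

/-! ### Algebraic decision diagrams -/

/-- A node of a decision diagram with `m` nodes: a terminal carrying a real constant, or a
decision node testing `x_i`, with successor `hi` if `x_i = 1` and `lo` if `x_i = 0`. -/
inductive ADDNode (I m : ℕ) : Type
  | terminal (c : ℝ) : ADDNode I m
  | decision (i : Fin I) (hi lo : Fin m) : ADDNode I m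

/-- The position in the variable order `pos` of the variable that a node tests; terminals come
after all the variables. -/
def ADDNode.level {I m : ℕ} (pos : Equiv.Perm (Fin I)) : ADDNode I m → ℕ
  | .terminal _ => I
  | .decision i _ _ => (pos i : ℕ)

/-- An algebraic decision diagram: a finite diagram with a root, whose nodes may be shared, in
which the variables are inspected along every path in one common order `pos` (which belongs to
the diagram and is arbitrary).  Variables may be skipped along a path. -/
structure ADD (I : ℕ) where
  numNodes : ℕ
  node : Fin numNodes → ADDNode I numNodes
  root : Fin numNodes
  pos : Equiv.Perm (Fin I)
  ordered : ∀ u i hi lo, node u = .decision i hi lo →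
    (pos i : ℕ) < (node hi).level pos ∧ (pos i : ℕ) < (node lo).level pos

namespace ADD

variable {I : ℕ}

/-- The value of the sub-diagram rooted at the node `u`. -/
def evalAt (D : ADD I) (x : BVec I) (u : Fin D.numNodes) : ℝ :=
  match h : D.node u with
  | .terminal c => c
  | .decision i hi lo => if x i = true then D.evalAt x hi else D.evalAt x lo
termination_by I - (D.node u).level D.pos
decreasing_by
  all_goals
    have h1 := D.ordered u i hi lo h
    have h2 := (D.pos i).isLt
    rw [h]
    simp only [ADDNode.level] at h1 ⊢
    omega

def eval (D : ADD I) (x : BVec I) : ℝ := D.evalAt x D.root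

/-- The number of nodes of the diagram, each shared node being counted once. -/
def size (D : ADD I) : ℕ := D.numNodes

def Represents (D : ADD I) (f : BVec I → ℝ) : Prop :=
  ∀ x, D.eval x = f x

end ADD

/-! ### Rule systems -/

/-- A rule system: rules `⋀_{(i, v) ∈ A_r} (x_i = v) ⇒ c_r` whose antecedents are mutually
exclusive and jointly exhaustive on `𝔹^I`. -/
structure RuleSystem (I : ℕ) where
  numRules : ℕ
  antecedents : Fin numRules → Finset (Fin I × Bool)
  value : Fin numRules → ℝ
  existsUnique_rule : ∀ x : BVec I, ∃! r, ∀ p ∈ antecedents r, x p.1 = p.2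

namespace RuleSystem

variable {I : ℕ}

/-- The number of rules plus the total number of literals in their antecedents. -/
def size (S : RuleSystem I) : ℕ := ∑ r, (1 + (S.antecedents r).card)

def Represents (S : RuleSystem I) (f : BVec I → ℝ) : Prop :=
  ∀ r x, (∀ p ∈ S.antecedents r, x p.1 = p.2) → f x = S.value r

end RuleSystem

/-! ### MILP-based feature representations -/

/-- A system of `Fc` linear inequalities with integer data in `F` feature variables, `Fl`
continuous and `Fb` binary auxiliary variables, and `I` input variables. -/
structure MILPSystem (I F : ℕ) where
  Fl : ℕ
  Fb : ℕ
  Fc : ℕ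
  coefFeature : Fin Fc → Fin F → ℤ
  coefCont : Fin Fc → Fin Fl → ℤ
  coefBin : Fin Fc → Fin Fb → ℤ
  coefInput : Fin Fc → Fin I → ℤ
  rhs : Fin Fc → ℤ

namespace MILPSystem

variable {I F : ℕ}

/-- `(φ, ζ; x)`, with `ζ = (ζl, ζb)`, lies in the polyhedron of the system. -/
def Mem (P : MILPSystem I F) (φ : BVec F) (ζl : Fin P.Fl → ℝ) (ζb : BVec P.Fb) (x : BVec I) :
    Prop :=
  ∀ k, ∑ j, (P.coefFeature k j : ℝ) * ((φ j).toNat : ℝ)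
      + ∑ j, (P.coefCont k j : ℝ) * ζl j
      + ∑ j, (P.coefBin k j : ℝ) * ((ζb j).toNat : ℝ)
      + ∑ j, (P.coefInput k j : ℝ) * ((x j).toNat : ℝ) ≤ (P.rhs k : ℝ)

/-- The bit length of an integer; it is `0` for the integer `0`, so that only nonzero
coefficients are charged. -/
def bits (z : ℤ) : ℕ := Nat.size z.natAbs

/-- The number of variables (features and auxiliary variables) and constraints, plus the bit
lengths of all the coefficients and right-hand sides. -/
def size (P : MILPSystem I F) : ℕ :=
  F + P.Fl + P.Fb + P.Fc
    + ∑ k, (∑ j, bits (P.coefFeature k j) + ∑ j, bits (P.coefCont k j)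
        + ∑ j, bits (P.coefBin k j) + ∑ j, bits (P.coefInput k j) + bits (P.rhs k))

end MILPSystem

/-- An MILP-based feature representation `x ↦ ρ (φ x)`: a feature map `φ : 𝔹^I → 𝔹^F` together
with a mixed-integer linear representation of it, and a function `ρ : 𝔹^F → ℝ` that depends on
the features in `scope` only. -/
structure MILPFeatureRep (I : ℕ) where
  F : ℕ
  φ : BVec I → BVec F
  milp : MILPSystem I F
  φ_eq_iff : ∀ x φ', φ x = φ' ↔ ∃ ζl ζb, milp.Mem φ' ζl ζb x
  ρ : BVec F → ℝ
  scope : Finset (Fin F)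
  ρ_scope : ∀ φ' φ'' : BVec F, (∀ j ∈ scope, φ' j = φ'' j) → ρ φ' = ρ φ''

namespace MILPFeatureRep

variable {I : ℕ}

/-- The size of the mixed-integer linear system plus the number `2 ^ |scope|` of entries of the
table of values of `ρ`; so the scope is at most logarithmic in the size. -/
def size (R : MILPFeatureRep I) : ℕ := R.milp.size + 2 ^ R.scope.card

def Represents (R : MILPFeatureRep I) (f : BVec I → ℝ) : Prop :=
  ∀ x, R.ρ (R.φ x) = f x

end MILPFeatureRep

/-! ### Parity and binary multiplication -/

/-- `1` if the number of ones in `x` is even, and `0` otherwise. -/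
def parity (I : ℕ) (x : BVec I) : ℝ :=
  if Even (∑ i, (x i).toNat) then 1 else 0

/-- The natural number with the binary digits `a`, the least significant one first. -/
def binVal {I : ℕ} (a : BVec I) : ℕ := ∑ i : Fin I, (a i).toNat * 2 ^ (i : ℕ)

/-- The bit of weight `2 ^ k` of the product of the `I`-bit numbers `a` and `b`, the input being
the vector `(a, b)` of length `I + I`. -/
def mulBit (I k : ℕ) (x : BVec (I + I)) : ℝ :=
  if (binVal (fun i : Fin I => x (Fin.castAdd I i))
      * binVal (fun i : Fin I => x (Fin.natAdd I i))).testBit k = true then 1 else 0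

end CSI

end

noncomputable section

namespace CSI

open MILPSystem (bits)

/-! ### Sparse linear constraints -/

/-! Simulation. The table of `ρ` costs `2 ^ |J|`, so `ρ` may read only logarithmically many
features. These are the bits of a short code (`exists_injective_code`) of the rule that applies or
of the terminal that is reached. For rules, each bit is forced by an inequality that becomes slack
once a literal is violated (`exists_rep_of_rules`); the leaves of a tree are rules. In an ADD, every
node copies the code of its terminal from the selected successor (`ADD.exists_rep`).

Small systems. Parity is a chain of xor gates. For multiplication, weights `2 ^ i` as coefficients
would have quadratic total bit length; continuous shift registers `2 s_{i+1} = s_i + d_i` produce `∑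
d_i 2 ^ i / 2 ^ n` with bounded coefficients (`isFeatureSystem_mulSystem`).

Lower bounds. If flipping any component changes `f`, two inputs cannot share a rule or a leaf, so `2
^ I` of them are needed. For ADDs, inputs that differ before a cut of the variable order and define
different subfunctions reach different nodes (`ADD.card_le_size_of_fooling`). The cut is chosen so
that half of the first `4 q` digits of the first factor precede it. Pigeonhole
(`exists_split_shift`) yields a distance `d` at which at least `q` pairs of digits are separated by
the cut. The second factor `2 ^ p + 2 ^ (p + d)` adds the two windows formed by such pairs, and the
middle bit of the product is the carry of that addition. It compares a number written before the cut
with one written after it (`testBit_fooling`), which distinguishes `2 ^ q` prefixes.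

For one function to defeat all three models, `mulParity` encodes the middle bit and the parity
together. -/

theorem bits_le_iff {z : ℤ} {k : ℕ} : bits z ≤ k ↔ z.natAbs < 2 ^ k := Nat.size_le

theorem natAbs_lt_two_pow_bits (z : ℤ) : z.natAbs < 2 ^ bits z := bits_le_iff.1 le_rfl

/-- The product `(|a| + 1) (|b| + 1)` exceeds `|a| + |b|` and is at most `2 ^ (bits a + bits b)`.
This is needed because the coefficients of a variable that occurs repeatedly in a list of terms are
added. -/
theorem bits_add_le (a b : ℤ) : bits (a + b) ≤ bits a + bits b := by
  rw [bits_le_iff, pow_add]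
  have h := Nat.mul_le_mul (natAbs_lt_two_pow_bits a) (natAbs_lt_two_pow_bits b)
  have h' := Int.natAbs_add_le a b
  simp only [Nat.succ_eq_add_one] at h
  nlinarith [Nat.zero_le (a.natAbs * b.natAbs)]

theorem bits_le_natAbs (z : ℤ) : bits z ≤ z.natAbs := bits_le_iff.2 Nat.lt_two_pow_self

@[simp] theorem bits_zero : bits 0 = 0 := by simp [bits]

@[simp] theorem bits_one : bits 1 = 1 := by simp [bits]

@[simp] theorem bits_two : bits 2 = 2 := by decide

@[simp] theorem bits_neg (z : ℤ) : bits (-z) = bits z := by simp [bits]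

/-- A linear inequality `∑ a_v v ≤ rhs` over variables `v : V`, given by the list of its terms. -/
structure Constraint (V : Type) where
  lhs : List (ℤ × V)
  rhs : ℤ

namespace Constraint

variable {V W : Type}

def Holds (c : Constraint V) (v : V → ℝ) : Prop :=
  (c.lhs.map fun p => (p.1 : ℝ) * v p.2).sum ≤ (c.rhs : ℝ)

/-- The bit length of the data of a constraint. -/
def cost (c : Constraint V) : ℕ := (c.lhs.map fun p => bits p.1).sum + bits c.rhs

def rename (g : V → W) (c : Constraint V) : Constraint W :=
  ⟨c.lhs.map fun p => (p.1, g p.2), c.rhs⟩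

theorem holds_rename (g : V → W) (c : Constraint V) (v : W → ℝ) :
    (c.rename g).Holds v ↔ c.Holds (v ∘ g) := by
  simp [rename, Holds, Function.comp_def]

@[simp] theorem cost_rename (g : V → W) (c : Constraint V) : (c.rename g).cost = c.cost := by
  simp [rename, cost, Function.comp_def]

open Classical in
/-- The coefficient of the variable `v` in a list of terms. -/
def coef (l : List (ℤ × V)) (v : V) : ℤ :=
  (l.map fun p => if v = p.2 then p.1 else 0).sum

theorem sum_coef_mul [Fintype V] (l : List (ℤ × V)) (val : V → ℝ) :
    ∑ v, (coef l v : ℝ) * val v = (l.map fun p => (p.1 : ℝ) * val p.2).sum := by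
  classical
  induction l with
  | nil => simp [coef]
  | cons p l ih =>
    have : ∀ v, (coef (p :: l) v : ℝ) * val v
        = (if v = p.2 then (p.1 : ℝ) * val v else 0) + (coef l v : ℝ) * val v := by
      intro v
      simp only [coef, List.map_cons, List.sum_cons]
      split_ifs <;> push_cast <;> ring
    simp only [this, Finset.sum_add_distrib, ih, Finset.sum_ite_eq', Finset.mem_univ, if_true,
      List.map_cons, List.sum_cons]

theorem sum_bits_coef_le [Fintype V] (l : List (ℤ × V)) :
    ∑ v, bits (coef l v) ≤ (l.map fun p => bits p.1).sum := by
  classical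
  induction l with
  | nil => simp [coef]
  | cons p l ih =>
    have : ∀ v, bits (coef (p :: l) v) ≤ (if v = p.2 then bits p.1 else 0) + bits (coef l v) := by
      intro v
      simp only [coef, List.map_cons, List.sum_cons]
      refine (bits_add_le _ _).trans ?_
      split_ifs <;> simp
    refine (Finset.sum_le_sum fun v _ => this v).trans ?_
    simp only [Finset.sum_add_distrib, Finset.sum_ite_eq', Finset.mem_univ, if_true,
      List.map_cons, List.sum_cons]
    lia

end Constraint

/-- The assignment of the features `φ`, the continuous variables `ζ` and the input `x`. -/
def assign {Φ L : Type} {I : ℕ} (φ : Φ → Bool) (ζ : L → ℝ) (x : BVec I) : Φ ⊕ L ⊕ Fin I → ℝ :=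
  Sum.elim (fun j => ((φ j).toNat : ℝ)) (Sum.elim ζ fun i => ((x i).toNat : ℝ))

/-- The constraints determine the features `φ x`, the variables in `L` being existentially
quantified. -/
def IsFeatureSystem {Φ L : Type} {I : ℕ} (cons : List (Constraint (Φ ⊕ L ⊕ Fin I)))
    (φ : BVec I → Φ → Bool) : Prop :=
  ∀ x φ', φ x = φ' ↔ ∃ ζ : L → ℝ, ∀ c ∈ cons, c.Holds (assign φ' ζ x)

/-- The number of constraints plus the bit length of their data. -/
def totalCost {V : Type} (cons : List (Constraint V)) : ℕ := (cons.map fun c => 1 + c.cost).sum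

theorem totalCost_append {V : Type} (l l' : List (Constraint V)) :
    totalCost (l ++ l') = totalCost l + totalCost l' := by
  simp [totalCost]

theorem totalCost_map_rename {V W : Type} (g : V → W) (l : List (Constraint V)) :
    totalCost (l.map (Constraint.rename g)) = totalCost l := by
  simp [totalCost, Function.comp_def]

theorem totalCost_flatMap_le {α V : Type} (l : List α) (g : α → List (Constraint V)) (w : ℕ)
    (h : ∀ a ∈ l, totalCost (g a) ≤ w) : totalCost (l.flatMap g) ≤ l.length * w := by
  induction l with
  | nil => simp [totalCost]
  | cons a l ih =>
    rw [List.flatMap_cons, totalCost_append, List.length_cons]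
    have h1 := h a (by simp)
    have h2 := ih fun b hb => h b (by simp [hb])
    lia

section Build

variable {Φ L : Type} [Fintype Φ] [Fintype L] {I : ℕ}

/-- The system in matrix form of a list of constraints. -/
abbrev toMILPSystem (cons : List (Constraint (Φ ⊕ L ⊕ Fin I))) :
    MILPSystem I (Fintype.card Φ) where
  Fl := Fintype.card L
  -- Integrality is only required of the features themselves; all auxiliary variables are
  -- continuous.
  Fb := 0
  Fc := cons.length
  coefFeature k j := Constraint.coef cons[k].lhs (.inl ((Fintype.equivFin Φ).symm j))
  coefCont k j := Constraint.coef cons[k].lhs (.inr (.inl ((Fintype.equivFin L).symm j)))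
  coefBin _ _ := 0
  coefInput k j := Constraint.coef cons[k].lhs (.inr (.inr j))
  rhs k := cons[k].rhs

theorem toMILPSystem_mem (cons : List (Constraint (Φ ⊕ L ⊕ Fin I)))
    (φ : BVec (Fintype.card Φ)) (ζ : Fin (Fintype.card L) → ℝ) (ζb : BVec 0) (x : BVec I) :
    (toMILPSystem cons).Mem φ ζ ζb x ↔
      ∀ c ∈ cons, c.Holds (assign (φ ∘ Fintype.equivFin Φ) (ζ ∘ Fintype.equivFin L) x) := by
  rw [List.forall_mem_iff_forall_getElem]
  refine Iff.trans (forall_congr' fun k : Fin cons.length => ?_) (Fin.forall_iff (p := fun k =>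
    (cons[k]).Holds (assign (φ ∘ Fintype.equivFin Φ) (ζ ∘ Fintype.equivFin L) x)))
  simp only [Constraint.Holds, ← Constraint.sum_coef_mul, Fintype.sum_sum_type,
    ← (Fintype.equivFin Φ).symm.sum_comp, ← (Fintype.equivFin L).symm.sum_comp]
  simp [assign, add_assoc]

theorem toMILPSystem_size_le (cons : List (Constraint (Φ ⊕ L ⊕ Fin I))) :
    (toMILPSystem cons).size ≤ Fintype.card Φ + Fintype.card L + totalCost cons := by
  have h : ∀ k : Fin cons.length, _ ≤ Constraint.cost cons[k] := fun k =>
    Nat.add_le_add_right (Constraint.sum_bits_coef_le cons[k].lhs) (bits cons[k].rhs)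
  have h' := Finset.sum_le_sum fun k (_ : k ∈ Finset.univ) => h k
  simp only [Fin.getElem_fin, Fin.sum_univ_fun_getElem cons Constraint.cost, Fintype.sum_sum_type,
    ← (Fintype.equivFin Φ).symm.sum_comp, ← (Fintype.equivFin L).symm.sum_comp] at h'
  have e : totalCost cons = cons.length + (cons.map Constraint.cost).sum := by
    simp [totalCost, List.sum_map_add]
  rw [e]
  refine le_trans (le_of_eq ?_)
    (Nat.add_le_add_left h' (Fintype.card Φ + Fintype.card L + cons.length) |>.trans (le_of_eq (by ring)))
  simp only [MILPSystem.size, add_assoc, bits_zero, Fin.getElem_fin, Finset.univ_eq_empty,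
    Finset.sum_empty, zero_add]

/-- A representation from a system of constraints and a function of the features in `S`. -/
theorem IsFeatureSystem.exists_rep {cons : List (Constraint (Φ ⊕ L ⊕ Fin I))}
    {φ : BVec I → Φ → Bool} (h : IsFeatureSystem cons φ) (S : Finset Φ) (ρ : (Φ → Bool) → ℝ)
    (hρ : ∀ φ' φ'' : Φ → Bool, (∀ j ∈ S, φ' j = φ'' j) → ρ φ' = ρ φ'') :
    ∃ R : MILPFeatureRep I, R.Represents (fun x => ρ (φ x)) ∧ Fintype.card Φ ≤ R.size ∧
      R.size ≤ Fintype.card Φ + Fintype.card L + totalCost cons + 2 ^ S.card := by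
  let e := Fintype.equivFin Φ
  let R : MILPFeatureRep I :=
    { F := Fintype.card Φ
      φ := fun x => φ x ∘ e.symm
      milp := toMILPSystem cons
      φ_eq_iff := by
        intro x φ'
        have h1 : φ x ∘ e.symm = φ' ↔ φ x = φ' ∘ e :=
          (Equiv.comp_symm_eq e φ' (φ x))
        rw [h1, h x]
        constructor
        · rintro ⟨ζ, hζ⟩
          refine ⟨ζ ∘ (Fintype.equivFin L).symm, Fin.elim0, ?_⟩
          refine (toMILPSystem_mem ..).2 ?_
          simpa [Function.comp_assoc] using hζ
        · rintro ⟨ζ, ζb, hζ⟩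
          exact ⟨_, (toMILPSystem_mem ..).1 hζ⟩
      ρ := fun φ' => ρ (φ' ∘ e)
      scope := S.map e.toEmbedding
      ρ_scope := by
        intro φ' φ'' hs
        refine hρ _ _ fun j hj => hs _ ?_
        simpa using hj }
  refine ⟨R, fun x => ?_, ?_, ?_⟩
  · simp [R, Function.comp_assoc]
  · simp only [MILPFeatureRep.size, MILPSystem.size, R]
    lia
  · have := toMILPSystem_size_le cons
    simpa [MILPFeatureRep.size, R] using this

end Build

/-- Two systems over the same input, side by side. -/
def joinSystems {Φ Φ' L L' : Type} {I : ℕ} (cons : List (Constraint (Φ ⊕ L ⊕ Fin I)))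
    (cons' : List (Constraint (Φ' ⊕ L' ⊕ Fin I))) :
    List (Constraint ((Φ ⊕ Φ') ⊕ (L ⊕ L') ⊕ Fin I)) :=
  cons.map (.rename (Sum.map .inl (Sum.map .inl id))) ++
    cons'.map (.rename (Sum.map .inr (Sum.map .inr id)))

theorem totalCost_joinSystems {Φ Φ' L L' : Type} {I : ℕ}
    (cons : List (Constraint (Φ ⊕ L ⊕ Fin I))) (cons' : List (Constraint (Φ' ⊕ L' ⊕ Fin I))) :
    totalCost (joinSystems cons cons') = totalCost cons + totalCost cons' := by
  simp only [joinSystems, totalCost_append, totalCost_map_rename]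

theorem IsFeatureSystem.join {Φ Φ' L L' : Type} {I : ℕ}
    {cons : List (Constraint (Φ ⊕ L ⊕ Fin I))} {cons' : List (Constraint (Φ' ⊕ L' ⊕ Fin I))}
    {φ : BVec I → Φ → Bool} {φ' : BVec I → Φ' → Bool}
    (h : IsFeatureSystem cons φ) (h' : IsFeatureSystem cons' φ') :
    IsFeatureSystem (joinSystems cons cons') (fun x => Sum.elim (φ x) (φ' x)) := by
  intro x ψ
  have e1 : ∀ ζ : L ⊕ L' → ℝ, assign ψ ζ x ∘ Sum.map .inl (Sum.map .inl id)
      = assign (ψ ∘ .inl) (ζ ∘ .inl) x := fun ζ => by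
    ext v; rcases v with v | v | v <;> rfl
  have e2 : ∀ ζ : L ⊕ L' → ℝ, assign ψ ζ x ∘ Sum.map .inr (Sum.map .inr id)
      = assign (ψ ∘ .inr) (ζ ∘ .inr) x := fun ζ => by
    ext v; rcases v with v | v | v <;> rfl
  have e3 : Sum.elim (φ x) (φ' x) = ψ ↔ φ x = ψ ∘ .inl ∧ φ' x = ψ ∘ .inr := by
    constructor
    · rintro rfl
      simp
    · rintro ⟨h1, h2⟩
      rw [h1, h2, Sum.elim_comp_inl_inr]
  rw [e3, h x, h' x]
  simp only [joinSystems, List.forall_mem_append, List.forall_mem_map, Constraint.holds_rename,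
    e1, e2]
  constructor
  · rintro ⟨⟨ζ, hζ⟩, ζ', hζ'⟩
    exact ⟨Sum.elim ζ ζ', by simpa using hζ, by simpa using hζ'⟩
  · rintro ⟨ζ, hζ, hζ'⟩
    exact ⟨⟨_, hζ⟩, _, hζ'⟩

/-! ### Representations of rule systems -/

/-- Short binary codes for the elements of a nonempty type with at most `s` elements. -/
theorem exists_injective_code (Λ : Type) [Fintype Λ] [Nonempty Λ] {s : ℕ}
    (h : Fintype.card Λ ≤ s) :
    0 < s ∧ ∃ B ≤ s, 2 ^ B ≤ 2 * s ∧ ∃ code : Λ → Fin B → Bool, Function.Injective code := by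
  have hs : 0 < s := Fintype.card_pos.trans_le h
  have hc : Fintype.card Λ ≤ Fintype.card (Fin (Nat.log 2 s + 1) → Bool) := by
    simpa using h.trans (Nat.lt_pow_succ_log_self one_lt_two s).le
  obtain ⟨g⟩ := Function.Embedding.nonempty_of_card_le hc
  -- With `log₂ s + 1` bits the code is injective, and yet a table indexed by all codes has at most
  -- `2 s` entries.
  refine ⟨hs, _, Nat.log_lt_self 2 hs.ne', ?_, g, g.injective⟩
  rw [pow_succ, mul_comm]
  exact Nat.mul_le_mul_left 2 (Nat.pow_log_le_self 2 hs.ne')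

section Rules

variable {I : ℕ} {Λ : Type}

/-- The literals of `A` that `x` violates. -/
def violated (A : Finset (Fin I × Bool)) (x : BVec I) : Finset (Fin I × Bool) :=
  A.filter fun p => x p.1 ≠ p.2

theorem violated_eq_empty {A : Finset (Fin I × Bool)} {x : BVec I} :
    violated A x = ∅ ↔ ∀ p ∈ A, x p.1 = p.2 := by
  simp [violated, Finset.filter_eq_empty_iff]

/-- The constraint `[w ≠ β] ≤ #(violated literals of A)` for the binary variable `w`. -/
def ruleConstraint {V : Type} (w : V) (input : Fin I → V) (A : Finset (Fin I × Bool)) (β : Bool) :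
    Constraint V where
  lhs := (if β then -1 else 1, w) :: A.toList.map fun p => (if p.2 then 1 else -1, input p.1)
  rhs := (A.filter fun p => p.2 = true).card - if β then 1 else 0

theorem ruleConstraint_holds {V : Type} {w : V} {input : Fin I → V} {A : Finset (Fin I × Bool)}
    {β : Bool} {v : V → ℝ} {x : BVec I} (b : Bool) (hw : v w = (b.toNat : ℝ))
    (hx : ∀ i, v (input i) = ((x i).toNat : ℝ)) :
    (ruleConstraint w input A β).Holds v ↔ (violated A x = ∅ → b = β) := by
  -- The number of violated literals is affine in `x`: a literal `x_i = 1` contributes `1 - x_i` and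
  -- a literal `x_i = 0` contributes `x_i`. The constants `1` are collected on the right-hand side.
  have key : (A.toList.map fun p => ((if p.2 then 1 else -1 : ℤ) : ℝ) * v (input p.1)).sum
      = (A.filter fun p => p.2 = true).card - (violated A x).card := by
    rw [Finset.sum_map_toList, violated, Finset.card_filter, Finset.card_filter]
    push_cast
    rw [← Finset.sum_sub_distrib]
    refine Finset.sum_congr rfl fun p _ => ?_
    rw [hx]
    rcases p with ⟨i, v⟩
    cases v <;> cases x i <;> simp
  have hv : violated A x ≠ ∅ → (1 : ℝ) ≤ (violated A x).card := fun h => by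
    exact_mod_cast Finset.card_pos.2 (Finset.nonempty_iff_ne_empty.2 h)
  have hb : (violated A x = ∅) → ((violated A x).card : ℝ) = 0 := fun h => by simp [h]
  simp only [ruleConstraint, Constraint.Holds, List.map_cons, List.sum_cons, List.map_map,
    Function.comp_def, key, hw]
  push_cast
  by_cases h : violated A x = ∅
  · rw [hb h]
    cases b <;> cases β <;> simp [h]
  · have := hv h
    cases b <;> cases β <;> simp [h] <;> linarith

theorem ruleConstraint_cost_le {V : Type} (w : V) (input : Fin I → V) (A : Finset (Fin I × Bool))
    (β : Bool) : (ruleConstraint w input A β).cost ≤ 2 * A.card + 2 := by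
  have h1 : (A.toList.map fun p => bits (if p.2 then 1 else -1)).sum = A.card := by
    rw [Finset.sum_map_toList, Finset.card_eq_sum_ones]
    exact Finset.sum_congr rfl fun p _ => by split_ifs <;> simp
  have h2 : bits (if β then -1 else 1) = 1 := by split_ifs <;> simp
  have h3 : bits ((A.filter fun p => p.2 = true).card - if β then 1 else 0) ≤ A.card + 1 := by
    refine (bits_le_natAbs _).trans ?_
    have := Finset.card_filter_le A fun p => p.2 = true
    split_ifs <;> lia
  simp only [ruleConstraint, Constraint.cost, List.map_cons, List.sum_cons, List.map_map,
    Function.comp_def, h1, h2]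
  lia

/-- A family of mutually exclusive and jointly exhaustive rules is simulated by a system whose
features are the bits of a code of the rule that applies. -/
theorem exists_rep_of_rules [Fintype Λ] (A : Λ → Finset (Fin I × Bool)) (val : Λ → ℝ)
    (hA : ∀ x : BVec I, ∃! r, ∀ p ∈ A r, x p.1 = p.2) {f : BVec I → ℝ}
    (hf : ∀ r x, (∀ p ∈ A r, x p.1 = p.2) → f x = val r) {s : ℕ} (hs : Fintype.card Λ ≤ s)
    (hAs : ∀ r, (A r).card ≤ s) :
    ∃ R : MILPFeatureRep I, R.Represents f ∧ R.size ≤ 100 * s ^ 3 := by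
  choose rule hrule huniq using hA
  have : Nonempty Λ := ⟨rule fun _ => false⟩
  obtain ⟨h1, B, hBs, hBp, code, hcode⟩ := exists_injective_code Λ hs
  let cons : List (Constraint (Fin B ⊕ Empty ⊕ Fin I)) :=
    (Finset.univ : Finset (Λ × Fin B)).toList.flatMap fun q =>
      [ruleConstraint (.inl q.2) (fun i => .inr (.inr i)) (A q.1) (code q.1 q.2)]
  have hsys : IsFeatureSystem cons fun x => code (rule x) := by
    intro x φ'
    have hc : ∀ ζ : Empty → ℝ, (∀ c ∈ cons, c.Holds (assign φ' ζ x)) ↔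
        ∀ r b, violated (A r) x = ∅ → φ' b = code r b := by
      intro ζ
      have : ∀ r b, (ruleConstraint (.inl b) (fun i => .inr (.inr i)) (A r) (code r b)).Holds
          (assign φ' ζ x) ↔ (violated (A r) x = ∅ → φ' b = code r b) := fun r b =>
        ruleConstraint_holds (φ' b) rfl fun i => rfl
      simp only [cons, List.forall_mem_flatMap, Finset.mem_toList, Finset.mem_univ,
        forall_true_left, Prod.forall, List.forall_mem_singleton, this]
    simp only [hc, exists_const, violated_eq_empty]
    constructor
    · rintro rfl r b hr
      rw [huniq x r hr]
    · exact fun h => funext fun b => (h _ b (hrule x)).symm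
  -- `ρ` decodes the rule and returns its value; the value `0` at words that are no code is never
  -- attained.
  obtain ⟨R, hR, -, hRs⟩ := hsys.exists_rep Finset.univ (Function.extend code val 0)
    (fun φ' φ'' h => by rw [funext fun j => h j (Finset.mem_univ j)])
  refine ⟨R, fun x => ?_, hRs.trans ?_⟩
  · rw [hR x, hf _ _ (hrule x)]
    exact hcode.extend_apply _ _ _
  · have hcost : totalCost cons ≤ (s * s) * (2 * s + 3) := by
      refine (totalCost_flatMap_le _ _ (2 * s + 3) fun q _ => ?_).trans ?_
      · have := ruleConstraint_cost_le (V := Fin B ⊕ Empty ⊕ Fin I) (.inl q.2)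
          (fun i => .inr (.inr i)) (A q.1) (code q.1 q.2)
        have := hAs q.1
        simp only [totalCost, List.map_cons, List.map_nil, List.sum_cons, List.sum_nil]
        lia
      · refine Nat.mul_le_mul_right _ ?_
        simpa using Nat.mul_le_mul hs hBs
    simp only [Fintype.card_fin, Fintype.card_empty, Finset.card_univ]
    have h2 : s ≤ s * s := Nat.le_mul_of_pos_left s h1
    have h3 : s * s ≤ s * s * s := Nat.le_mul_of_pos_right _ h1
    nlinarith

end Rules

/-- The leaves of a decision tree as a family of rules. -/
theorem DecisionTree.exists_rules {I : ℕ} (T : DecisionTree I) :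
    ∃ (Λ : Type) (_ : Fintype Λ) (A : Λ → Finset (Fin I × Bool)) (val : Λ → ℝ),
      (∀ x : BVec I, ∃! r, ∀ p ∈ A r, x p.1 = p.2) ∧
      (∀ r x, (∀ p ∈ A r, x p.1 = p.2) → T.eval x = val r) ∧
      Fintype.card Λ ≤ T.size ∧ ∀ r, (A r).card ≤ T.size := by
  classical
  induction T with
  | leaf c =>
    exact ⟨Unit, inferInstance, fun _ => ∅, fun _ => c, by simp [ExistsUnique], by simp [eval],
      by simp [size], by simp⟩
  | branch i hi lo ih1 ih2 =>
    obtain ⟨Λ₁, _, A₁, val₁, hA₁, hv₁, hc₁, hd₁⟩ := ih1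
    obtain ⟨Λ₂, _, A₂, val₂, hA₂, hv₂, hc₂, hd₂⟩ := ih2
    refine ⟨Λ₁ ⊕ Λ₂, inferInstance,
      Sum.elim (fun r => insert (i, true) (A₁ r)) (fun r => insert (i, false) (A₂ r)),
      Sum.elim val₁ val₂, fun x => ?_, ?_, ?_, ?_⟩
    · cases hx : x i
      · obtain ⟨r, hr, hu⟩ := hA₂ x
        refine ⟨.inr r, by simpa [hx] using hr, ?_⟩
        rintro (r' | r') h
        · simp [hx] at h
        · exact congrArg _ (hu r' (by simpa [hx] using h))
      · obtain ⟨r, hr, hu⟩ := hA₁ x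
        refine ⟨.inl r, by simpa [hx] using hr, ?_⟩
        rintro (r' | r') h
        · exact congrArg _ (hu r' (by simpa [hx] using h))
        · simp [hx] at h
    · rintro (r | r) x h
      · simp only [Sum.elim_inl, Finset.forall_mem_insert] at h
        simp [eval, h.1, hv₁ r x h.2]
      · simp only [Sum.elim_inr, Finset.forall_mem_insert] at h
        simp [eval, h.1, hv₂ r x h.2]
    · simp only [Fintype.card_sum, size]
      lia
    · rintro (r | r)
      · exact (Finset.card_insert_le _ _).trans (by have := hd₁ r; simp only [size]; lia)
      · exact (Finset.card_insert_le _ _).trans (by have := hd₂ r; simp only [size]; lia)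

theorem DecisionTree.exists_rep {I : ℕ} {f : BVec I → ℝ} (T : DecisionTree I)
    (hT : T.Represents f) :
    ∃ R : MILPFeatureRep I, R.Represents f ∧ R.size ≤ 100 * T.size ^ 3 := by
  obtain ⟨Λ, _, A, val, hA, hv, hc, hd⟩ := T.exists_rules
  exact exists_rep_of_rules A val hA (fun r x h => (hT x).symm.trans (hv r x h)) hc hd

theorem RuleSystem.numRules_le_size {I : ℕ} (S : RuleSystem I) : S.numRules ≤ S.size := by
  simp [size, Finset.sum_add_distrib]

theorem RuleSystem.exists_rep {I : ℕ} {f : BVec I → ℝ} (S : RuleSystem I) (hS : S.Represents f) :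
    ∃ R : MILPFeatureRep I, R.Represents f ∧ R.size ≤ 100 * S.size ^ 3 := by
  refine exists_rep_of_rules S.antecedents S.value S.existsUnique_rule hS
    (by simpa using S.numRules_le_size) fun r => ?_
  have := Finset.single_le_sum (f := fun r => 1 + (S.antecedents r).card)
    (fun _ _ => Nat.zero_le _) (Finset.mem_univ r)
  simp only [size]
  lia

/-! ### Representations of algebraic decision diagrams -/

namespace ADD

variable {I : ℕ}

/-- The first node at level at least `ℓ` on the path from the node `u` that `x` selects. -/
def reach (D : ADD I) (ℓ : ℕ) (x : BVec I) (u : Fin D.numNodes) : Fin D.numNodes :=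
  match _h : D.node u with
  | .terminal _ => u
  | .decision i hi lo =>
    if (D.pos i : ℕ) < ℓ then if x i = true then D.reach ℓ x hi else D.reach ℓ x lo else u
termination_by I - (D.node u).level D.pos
decreasing_by
  all_goals
    have h1 := D.ordered u i hi lo _h
    have := (D.pos i).isLt
    rw [_h]
    simp only [ADDNode.level] at h1 ⊢
    omega

/-- Induction along the edges of a diagram, from the terminals to the root. -/
theorem node_induction (D : ADD I) {motive : Fin D.numNodes → Prop}
    (terminal : ∀ u c, D.node u = .terminal c → motive u)
    (decision : ∀ u i hi lo, D.node u = .decision i hi lo → motive hi → motive lo → motive u)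
    (u : Fin D.numNodes) : motive u := by
  induction hk : I - (D.node u).level D.pos using Nat.strong_induction_on generalizing u with
  | _ k ih =>
    cases h : D.node u with
    | terminal c => exact terminal u c h
    | decision i hi lo =>
      have h1 := D.ordered u i hi lo h
      have h2 := (D.pos i).isLt
      rw [h] at hk
      change I - (D.pos i : ℕ) = k at hk
      exact decision u i hi lo h (ih _ (by lia) hi rfl) (ih _ (by lia) lo rfl)

variable (D : ADD I)

theorem evalAt_terminal {u : Fin D.numNodes} {c : ℝ} (h : D.node u = .terminal c) (x : BVec I) :
    D.evalAt x u = c := by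
  rw [evalAt]
  split <;> simp_all

theorem evalAt_decision {u : Fin D.numNodes} {i : Fin I} {hi lo : Fin D.numNodes}
    (h : D.node u = .decision i hi lo) (x : BVec I) :
    D.evalAt x u = if x i = true then D.evalAt x hi else D.evalAt x lo := by
  rw [evalAt]
  split <;> simp_all

theorem reach_terminal {u : Fin D.numNodes} {c : ℝ} (h : D.node u = .terminal c) (ℓ : ℕ)
    (x : BVec I) : D.reach ℓ x u = u := by
  rw [reach]
  split <;> simp_all

theorem reach_decision {u : Fin D.numNodes} {i : Fin I} {hi lo : Fin D.numNodes}
    (h : D.node u = .decision i hi lo) (ℓ : ℕ) (x : BVec I) :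
    D.reach ℓ x u =
      if (D.pos i : ℕ) < ℓ then if x i = true then D.reach ℓ x hi else D.reach ℓ x lo else u := by
  rw [reach]
  split <;> simp_all

theorem evalAt_reach (ℓ : ℕ) (x : BVec I) (u : Fin D.numNodes) :
    D.evalAt x (D.reach ℓ x u) = D.evalAt x u := by
  induction u using D.node_induction with
  | terminal u c h => rw [D.reach_terminal h]
  | decision u i hi lo h ih1 ih2 =>
    rw [D.reach_decision h]
    split_ifs with h1 h2
    · rw [ih1, D.evalAt_decision h, if_pos h2]
    · rw [ih2, D.evalAt_decision h, if_neg h2]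
    · rfl

theorem le_level_reach {ℓ : ℕ} (hℓ : ℓ ≤ I) (x : BVec I) (u : Fin D.numNodes) :
    ℓ ≤ (D.node (D.reach ℓ x u)).level D.pos := by
  induction u using D.node_induction with
  | terminal u c h => rw [D.reach_terminal h, h]; exact hℓ
  | decision u i hi lo h ih1 ih2 =>
    rw [D.reach_decision h]
    split_ifs with h1 h2
    · exact ih1
    · exact ih2
    · rw [h]
      exact not_lt.1 h1

/-- The constant of a terminal node. -/
def terminalValue (u : Fin D.numNodes) : ℝ :=
  match D.node u with
  | .terminal c => c
  | .decision _ _ _ => 0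

/-- Decision nodes have level below `I`, so the node reached at threshold `I` is a terminal, and the
default `0` of `terminalValue` plays no role. -/
theorem evalAt_eq_terminalValue (x : BVec I) (u : Fin D.numNodes) :
    D.evalAt x u = D.terminalValue (D.reach I x u) := by
  rw [← D.evalAt_reach I]
  have h := D.le_level_reach le_rfl x u
  cases h' : D.node (D.reach I x u) with
  | terminal c => rw [D.evalAt_terminal h', terminalValue, h']
  | decision i hi lo =>
    rw [h'] at h
    exact absurd (D.pos i).isLt (not_lt.2 h)

end ADD

/-- The constraints `w = β` for a binary variable `w`. -/
def constConstraint {V : Type} (w : V) (β : Bool) : Constraint V :=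
  if β then ⟨[(-1, w)], -1⟩ else ⟨[(1, w)], 0⟩

theorem constConstraint_holds {V : Type} {w : V} {β : Bool} {v : V → ℝ} (b : Bool)
    (hw : v w = (b.toNat : ℝ)) : (constConstraint w β).Holds v ↔ b = β := by
  cases b <;> cases β <;> simp [constConstraint, Constraint.Holds, hw]

/-- The constraints `w = if x then hi else lo` for binary variables. -/
def muxConstraints {V : Type} (w x hi lo : V) : List (Constraint V) :=
  [⟨[(1, w), (-1, hi), (1, x)], 1⟩, ⟨[(-1, w), (1, hi), (1, x)], 1⟩,
    ⟨[(1, w), (-1, lo), (-1, x)], 0⟩, ⟨[(-1, w), (1, lo), (-1, x)], 0⟩]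

/-- The first two inequalities are vacuous unless `x = 1`, the last two unless `x = 0`. -/
theorem muxConstraints_hold {V : Type} {w x hi lo : V} {v : V → ℝ} (bw bx bh bl : Bool)
    (hw : v w = (bw.toNat : ℝ)) (hx : v x = (bx.toNat : ℝ)) (hh : v hi = (bh.toNat : ℝ))
    (hl : v lo = (bl.toNat : ℝ)) :
    (∀ c ∈ muxConstraints w x hi lo, c.Holds v) ↔ bw = if bx = true then bh else bl := by
  simp only [muxConstraints, Constraint.Holds, List.forall_mem_cons, hw, hx, hh, hl, List.map_cons,
    List.map_nil, List.sum_cons, List.sum_nil]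
  cases bw <;> cases bx <;> cases bh <;> cases bl <;> norm_num

/-- The constraints of a node of a diagram, for one bit of the code of the terminal reached. -/
def nodeConstraints {V : Type} {I m : ℕ} (feature : Fin m → V) (input : Fin I → V)
    (u : Fin m) (β : Bool) : ADDNode I m → List (Constraint V)
  | .terminal _ => [constConstraint (feature u) β]
  | .decision i hi lo => muxConstraints (feature u) (input i) (feature hi) (feature lo)

theorem totalCost_nodeConstraints_le {V : Type} {I m : ℕ} (feature : Fin m → V)
    (input : Fin I → V) (u : Fin m) (β : Bool) (n : ADDNode I m) :
    totalCost (nodeConstraints feature input u β n) ≤ 20 := by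
  cases n with
  | terminal c =>
    cases β <;> simp [nodeConstraints, constConstraint, totalCost, Constraint.cost]
  | decision i hi lo => simp [nodeConstraints, muxConstraints, totalCost, Constraint.cost]

/-- The feature `(u, b)` is bit `b` of the code of the terminal that `x` reaches from `u`. Induction
from the terminals upwards shows that the local constraints leave no other choice. -/
theorem ADD.exists_rep {I : ℕ} {f : BVec I → ℝ} (D : ADD I) (hD : D.Represents f) :
    ∃ R : MILPFeatureRep I, R.Represents f ∧ R.size ≤ 100 * D.size ^ 3 := by
  have : Nonempty (Fin D.numNodes) := ⟨D.root⟩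
  obtain ⟨h1, B, hBs, hBp, code, hcode⟩ := exists_injective_code _ (Fintype.card_fin D.numNodes).le
  simp only [size]
  let cons : List (Constraint ((Fin D.numNodes × Fin B) ⊕ Empty ⊕ Fin I)) :=
    (Finset.univ : Finset (Fin D.numNodes × Fin B)).toList.flatMap fun q =>
      nodeConstraints (fun u => .inl (u, q.2)) (fun i => .inr (.inr i)) q.1 (code q.1 q.2)
        (D.node q.1)
  have hsys : IsFeatureSystem cons fun x q => code (D.reach I x q.1) q.2 := by
    intro x φ'
    have hc : ∀ ζ : Empty → ℝ, (∀ c ∈ cons, c.Holds (assign φ' ζ x)) ↔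
        ∀ u b, (∀ c, D.node u = .terminal c → φ' (u, b) = code u b) ∧
          ∀ i hi lo, D.node u = .decision i hi lo →
            φ' (u, b) = if x i = true then φ' (hi, b) else φ' (lo, b) := by
      intro ζ
      simp only [cons, List.forall_mem_flatMap, Finset.mem_toList, Finset.mem_univ,
        forall_true_left, Prod.forall]
      refine forall₂_congr fun u b => ?_
      cases h : D.node u with
      | terminal c =>
        simpa [nodeConstraints] using
          constConstraint_holds (w := .inl (u, b)) (v := assign φ' ζ x) (φ' (u, b)) rfl
      | decision i hi lo =>
        simp only [nodeConstraints]
        rw [muxConstraints_hold (v := assign φ' ζ x) (w := .inl (u, b)) (x := .inr (.inr i))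
          (hi := .inl (hi, b)) (lo := .inl (lo, b)) (φ' (u, b)) (x i) (φ' (hi, b)) (φ' (lo, b))
          rfl rfl rfl rfl]
        simp only [reduceCtorEq, false_imp_iff, implies_true, true_and, ADDNode.decision.injEq]
        exact ⟨by rintro h' _ _ _ ⟨rfl, rfl, rfl⟩; exact h', fun h' => h' _ _ _ ⟨rfl, rfl, rfl⟩⟩
    simp only [hc, exists_const]
    constructor
    · rintro rfl u b
      refine ⟨fun c h => ?_, fun i hi lo h => ?_⟩
      · simp only [D.reach_terminal h]
      · simp only [D.reach_decision h, (D.pos i).isLt, if_true]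
        split_ifs <;> rfl
    · intro h
      funext ⟨u, b⟩
      dsimp only
      induction u using D.node_induction with
      | terminal u c hu => rw [D.reach_terminal hu, (h u b).1 c hu]
      | decision u i hi lo hu ih1 ih2 =>
        rw [D.reach_decision hu, if_pos (D.pos i).isLt, (h u b).2 i hi lo hu, ← ih1, ← ih2]
        split_ifs <;> rfl
  -- Only the bits at the root enter the scope; the features at the other nodes do not enlarge the
  -- table of `ρ`.
  obtain ⟨R, hR, -, hRs⟩ := hsys.exists_rep ({D.root} ×ˢ Finset.univ)
    (fun φ' => Function.extend code D.terminalValue 0 fun b => φ' (D.root, b))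
    (fun φ' φ'' h => by
      rw [funext fun b => h (D.root, b) (by simp)])
  refine ⟨R, fun x => ?_, hRs.trans ?_⟩
  · rw [hR x, ← hD x, eval, D.evalAt_eq_terminalValue]
    exact hcode.extend_apply D.terminalValue 0 (D.reach I x D.root)
  · have hcost : totalCost cons ≤ (D.numNodes * D.numNodes) * 20 := by
      refine (totalCost_flatMap_le _ _ 20 fun q _ => ?_).trans ?_
      · exact totalCost_nodeConstraints_le ..
      · refine Nat.mul_le_mul_right _ ?_
        simpa using Nat.mul_le_mul_left D.numNodes hBs
    have h0 := Nat.mul_le_mul_left D.numNodes hBs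
    simp only [Fintype.card_prod, Fintype.card_fin, Fintype.card_empty, Finset.card_product,
      Finset.card_singleton, Finset.card_univ, one_mul]
    set s := D.numNodes
    have h2 : s ≤ s * s := Nat.le_mul_of_pos_left s h1
    have h3 : s * s ≤ s * s * s := Nat.le_mul_of_pos_right _ h1
    nlinarith

/-! ### A linear-size system for parity -/

/-- The constraints `w = u xor x` for binary variables. -/
def xorConstraints {V : Type} (w u x : V) : List (Constraint V) :=
  [⟨[(1, w), (-1, u), (-1, x)], 0⟩, ⟨[(-1, w), (1, u), (-1, x)], 0⟩,
    ⟨[(-1, w), (-1, u), (1, x)], 0⟩, ⟨[(1, w), (1, u), (1, x)], 2⟩]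

/-- Each inequality cuts off exactly one of the four binary points `(w, u, x)` with odd sum. -/
theorem xorConstraints_hold {V : Type} {w u x : V} {v : V → ℝ} (bw bu bx : Bool)
    (hw : v w = (bw.toNat : ℝ)) (hu : v u = (bu.toNat : ℝ)) (hx : v x = (bx.toNat : ℝ)) :
    (∀ c ∈ xorConstraints w u x, c.Holds v) ↔ bw = (bu ^^ bx) := by
  simp only [xorConstraints, Constraint.Holds, List.forall_mem_cons, hw, hu, hx, List.map_cons,
    List.map_nil, List.sum_cons, List.sum_nil]
  cases bw <;> cases bu <;> cases bx <;> norm_num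

/-- Whether the number of ones among the first `k` components of `x` is odd. -/
def oddPrefix {I : ℕ} (x : BVec I) (k : Fin (I + 1)) : Bool :=
  Fin.induction (motive := fun _ => Bool) false (fun i b => b ^^ x i) k

theorem oddPrefix_zero {I : ℕ} (x : BVec I) : oddPrefix x 0 = false := rfl

theorem oddPrefix_succ {I : ℕ} (x : BVec I) (i : Fin I) :
    oddPrefix x i.succ = (oddPrefix x i.castSucc ^^ x i) := by
  simp [oddPrefix, Fin.induction_succ]

theorem oddPrefix_castSucc {I : ℕ} (x : BVec (I + 1)) (k : Fin (I + 1)) :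
    oddPrefix x k.castSucc = oddPrefix (fun i => x i.castSucc) k := by
  induction k using Fin.induction with
  | zero => rfl
  | succ i ih => rw [Fin.castSucc_succ, oddPrefix_succ, ih, oddPrefix_succ]

theorem oddPrefix_last {I : ℕ} (x : BVec I) :
    oddPrefix x (Fin.last I) = decide (Odd (∑ i, (x i).toNat)) := by
  induction I with
  | zero => simp [oddPrefix]
  | succ I ih =>
    rw [← Fin.succ_last, oddPrefix_succ, oddPrefix_castSucc, ih, Fin.sum_univ_castSucc]
    cases x (Fin.last I) <;> simp [Nat.odd_add_one, -Nat.not_odd_iff_even]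

def paritySystem (I : ℕ) : List (Constraint (Fin (I + 1) ⊕ Empty ⊕ Fin I)) :=
  constConstraint (.inl 0) false ::
    (List.finRange I).flatMap fun i =>
      xorConstraints (.inl i.succ) (.inl i.castSucc) (.inr (.inr i))

theorem isFeatureSystem_paritySystem (I : ℕ) : IsFeatureSystem (paritySystem I) oddPrefix := by
  intro x φ'
  have hc : ∀ ζ : Empty → ℝ, (∀ c ∈ paritySystem I, c.Holds (assign φ' ζ x)) ↔
      φ' 0 = false ∧ ∀ i : Fin I, φ' i.succ = (φ' i.castSucc ^^ x i) := by
    intro ζ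
    have h : ∀ i : Fin I, _ := fun i => xorConstraints_hold (v := assign φ' ζ x)
      (w := .inl i.succ) (u := .inl i.castSucc) (x := .inr (.inr i)) (φ' i.succ)
      (φ' i.castSucc) (x i) rfl rfl rfl
    have h0 := constConstraint_holds (w := .inl 0) (v := assign φ' ζ x) (β := false) (φ' 0) rfl
    simp only [paritySystem, List.forall_mem_cons, List.forall_mem_flatMap, List.mem_finRange,
      forall_true_left, h, h0]
  simp only [hc, exists_const]
  constructor
  · rintro rfl
    exact ⟨oddPrefix_zero x, oddPrefix_succ x⟩
  · rintro ⟨h0, h⟩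
    funext k
    induction k using Fin.induction with
    | zero => rw [h0, oddPrefix_zero]
    | succ i ih => rw [oddPrefix_succ, ih, h]

theorem totalCost_paritySystem_le (I : ℕ) : totalCost (paritySystem I) ≤ 18 * I + 2 := by
  have h := totalCost_flatMap_le (List.finRange I) (fun i : Fin I =>
    xorConstraints (V := Fin (I + 1) ⊕ Empty ⊕ Fin I) (.inl i.succ) (.inl i.castSucc)
      (.inr (.inr i))) 18 fun i _ => by simp [xorConstraints, totalCost, Constraint.cost]
  rw [List.length_finRange] at h
  rw [paritySystem, ← List.singleton_append, totalCost_append]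
  have h0 : totalCost [constConstraint (V := Fin (I + 1) ⊕ Empty ⊕ Fin I) (.inl 0) false] = 2 := by
    simp [constConstraint, totalCost, Constraint.cost]
  lia

theorem parity_eq_oddPrefix {I : ℕ} (x : BVec I) :
    parity I x = if oddPrefix x (Fin.last I) = true then 0 else 1 := by
  rw [oddPrefix_last, parity]
  by_cases h : Even (∑ i, (x i).toNat) <;> simp [h]

theorem exists_parity_rep {I : ℕ} (hI : 1 ≤ I) :
    ∃ R : MILPFeatureRep I, R.Represents (parity I) ∧ R.size ≤ 30 * I := by
  -- All prefix parities are features, but `ρ` reads only the last one, so its table has two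
  -- entries.
  obtain ⟨R, hR, -, hs⟩ := (isFeatureSystem_paritySystem I).exists_rep {Fin.last I}
    (fun φ' => if φ' (Fin.last I) = true then 0 else 1) (fun φ' φ'' h => by simp [h])
  refine ⟨R, fun x => (hR x).trans (parity_eq_oddPrefix x).symm, hs.trans ?_⟩
  have := totalCost_paritySystem_le I
  simp only [Fintype.card_fin, Fintype.card_empty, Finset.card_singleton]
  lia

/-! ### A linear-size system for multiplication -/

/-- The equation `∑ a_v v = 0` as two inequalities. -/
def zeroConstraints {V : Type} (l : List (ℤ × V)) : List (Constraint V) :=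
  [⟨l, 0⟩, ⟨l.map fun p => (-p.1, p.2), 0⟩]

theorem zeroConstraints_hold {V : Type} {l : List (ℤ × V)} {v : V → ℝ} :
    (∀ c ∈ zeroConstraints l, c.Holds v) ↔ (l.map fun p => (p.1 : ℝ) * v p.2).sum = 0 := by
  have h : (l.map fun p => -((p.1 : ℝ) * v p.2)).sum = -(l.map fun p => (p.1 : ℝ) * v p.2).sum := by
    induction l with
    | nil => simp
    | cons p l ih => simp only [List.map_cons, List.sum_cons, ih]; ring
  simp only [zeroConstraints, Constraint.Holds, List.forall_mem_cons, List.map_map,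
    Function.comp_def, Int.cast_neg, neg_mul, h, Int.cast_zero]
  constructor
  · rintro ⟨h1, h2, -⟩
    linarith
  · intro h'
    simp [h']

/-- The recursion `2 s_{i+1} = s_i + d_i`, `s_0 = 0`, which shifts the digits `d_i` into `s`. -/
def shiftConstraints {V : Type} {n : ℕ} (state : Fin (n + 1) → V) (digit : Fin n → V) :
    List (Constraint V) :=
  zeroConstraints [(1, state 0)] ++ (List.finRange n).flatMap fun i =>
    zeroConstraints [(2, state i.succ), (-1, state i.castSucc), (-1, digit i)]

theorem shiftConstraints_hold {V : Type} {n : ℕ} {state : Fin (n + 1) → V} {digit : Fin n → V}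
    {v : V → ℝ} : (∀ c ∈ shiftConstraints state digit, c.Holds v) ↔
      v (state 0) = 0 ∧ ∀ i, 2 * v (state i.succ) = v (state i.castSucc) + v (digit i) := by
  simp only [shiftConstraints, List.forall_mem_append, List.forall_mem_flatMap,
    zeroConstraints_hold, List.mem_finRange, forall_true_left, List.map_cons, List.map_nil,
    List.sum_cons, List.sum_nil]
  refine and_congr (by simp) (forall_congr' fun i => ?_)
  push_cast
  constructor <;> intro h <;> linarith

theorem totalCost_shiftConstraints_le {V : Type} {n : ℕ} (state : Fin (n + 1) → V)
    (digit : Fin n → V) : totalCost (shiftConstraints state digit) ≤ 10 * n + 4 := by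
  have h := totalCost_flatMap_le (List.finRange n) (fun i =>
    zeroConstraints [(2, state i.succ), (-1, state i.castSucc), (-1, digit i)]) 10 fun i _ => by
      simp [zeroConstraints, totalCost, Constraint.cost]
  rw [List.length_finRange] at h
  have h0 : totalCost (zeroConstraints [(1, state 0)]) = 4 := by
    simp [zeroConstraints, totalCost, Constraint.cost]
  rw [shiftConstraints, totalCost_append]
  lia

/-- Each step halves what the register already holds, so digit `i` ends up with weight `2 ^ i / 2 ^
n`. The powers of two arise from iteration and not from large coefficients. -/
theorem shift_last {n : ℕ} {s : Fin (n + 1) → ℝ} {d : Fin n → ℝ} (h0 : s 0 = 0)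
    (h : ∀ i : Fin n, 2 * s i.succ = s i.castSucc + d i) :
    s (Fin.last n) * 2 ^ n = ∑ i, d i * 2 ^ (i : ℕ) := by
  induction n with
  | zero => simpa using h0
  | succ n ih =>
    have h1 := h (Fin.last n)
    have h2 := ih (s := fun k => s k.castSucc) (d := fun i => d i.castSucc) h0
      fun i => h i.castSucc
    rw [Fin.sum_univ_castSucc]
    simp only [Fin.val_castSucc, Fin.val_last, Fin.succ_last] at h1 ⊢
    rw [← h2, pow_succ]
    linear_combination 2 ^ n * h1

theorem exists_shift {n : ℕ} (d : Fin n → ℝ) :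
    ∃ s : Fin (n + 1) → ℝ, s 0 = 0 ∧ ∀ i : Fin n, 2 * s i.succ = s i.castSucc + d i := by
  refine ⟨fun k => Fin.induction (motive := fun _ => ℝ) 0 (fun i r => (r + d i) / 2) k, rfl,
    fun i => ?_⟩
  simp only [Fin.induction_succ]
  ring

/-- The constraints `z = a * y` for a binary variable `a` and a variable `y` in `[0, 1]`. -/
def productConstraints {V : Type} (z a y : V) : List (Constraint V) :=
  [⟨[(1, z), (-1, a)], 0⟩, ⟨[(1, z), (-1, y)], 0⟩, ⟨[(-1, z)], 0⟩, ⟨[(1, a), (1, y), (-1, z)], 1⟩]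

/-- These are the McCormick inequalities, which are exact when one factor is binary and the other
lies in `[0, 1]`. -/
theorem productConstraints_hold {V : Type} {z a y : V} {v : V → ℝ} (b : Bool)
    (ha : v a = (b.toNat : ℝ)) (h0 : 0 ≤ v y) (h1 : v y ≤ 1) :
    (∀ c ∈ productConstraints z a y, c.Holds v) ↔ v z = b.toNat * v y := by
  simp only [productConstraints, Constraint.Holds, List.forall_mem_cons, ha, List.map_cons,
    List.map_nil, List.sum_cons, List.sum_nil]
  push_cast
  cases b
  · simp only [Bool.toNat_false, Nat.cast_zero]
    constructor
    · rintro ⟨h2, -, h3, -⟩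
      linarith
    · intro h
      rw [h]
      refine ⟨?_, ?_, ?_, ?_, by simp⟩ <;> linarith
  · simp only [Bool.toNat_true, Nat.cast_one]
    constructor
    · rintro ⟨-, h2, -, h3, -⟩
      linarith
    · intro h
      rw [h]
      refine ⟨?_, ?_, ?_, ?_, by simp⟩ <;> linarith

theorem binVal_eq_ofBits {n : ℕ} (a : BVec n) : binVal a = Nat.ofBits a := by
  induction n with
  | zero => simp [binVal]
  | succ n ih =>
    have := ih (a ∘ Fin.succ)
    rw [Nat.ofBits_succ, ← this, binVal, binVal, Fin.sum_univ_succ, Finset.mul_sum, add_comm]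
    congr 1
    · refine Finset.sum_congr rfl fun i _ => ?_
      simp only [Function.comp_apply, Fin.val_succ, pow_succ]
      ring
    · simp

theorem binVal_lt {n : ℕ} (a : BVec n) : binVal a < 2 ^ n :=
  binVal_eq_ofBits a ▸ Nat.ofBits_lt_two_pow a

theorem testBit_eq_iff_binVal {n N : ℕ} (hN : N < 2 ^ n) (a : BVec n) :
    (fun k : Fin n => N.testBit k) = a ↔ binVal a = N := by
  rw [binVal_eq_ofBits]
  constructor
  · rintro rfl
    rw [Nat.ofBits_testBit, Nat.mod_eq_of_lt hN]
  · rintro rfl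
    funext k
    exact Nat.testBit_ofBits_lt a k k.isLt

/-- The continuous variables of the multiplication system: the shift register of the second
factor, its products with the bits of the first factor, and the shift registers of the sum of
these and of the bits of the product. -/
abbrev MulVar (I : ℕ) : Type :=
  (Fin (I + 1) ⊕ Fin I) ⊕ (Fin (I + 1) ⊕ Fin (2 * I + 1))

namespace MulVar

variable {I : ℕ}

abbrev V (I : ℕ) : Type := Fin (2 * I) ⊕ MulVar I ⊕ Fin (I + I)

abbrev bit (k : Fin (2 * I)) : V I := .inl k
abbrev factor (k : Fin (I + 1)) : V I := .inr (.inl (.inl (.inl k)))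
abbrev partialProduct (k : Fin I) : V I := .inr (.inl (.inl (.inr k)))
abbrev accumulator (k : Fin (I + 1)) : V I := .inr (.inl (.inr (.inl k)))
abbrev result (k : Fin (2 * I + 1)) : V I := .inr (.inl (.inr (.inr k)))
abbrev left (i : Fin I) : V I := .inr (.inr (Fin.castAdd I i))
abbrev right (i : Fin I) : V I := .inr (.inr (Fin.natAdd I i))

end MulVar

open MulVar in
-- With factors `a` and `b`, the register `factor` ends at `b / 2 ^ I`, the partial products are
-- `a_i b / 2 ^ I`, and `accumulator` ends at `a b / 2 ^ (2 I)`. The register `result` turns the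
-- features into a number on the same scale, and the last equation equates the two.
def mulSystem (I : ℕ) : List (Constraint (V I)) :=
  shiftConstraints factor right ++
    ((List.finRange I).flatMap fun i =>
      productConstraints (partialProduct i) (left i) (factor (Fin.last I))) ++
    shiftConstraints accumulator partialProduct ++ shiftConstraints result bit ++
    zeroConstraints [(1, result (Fin.last (2 * I))), (-1, accumulator (Fin.last I))]

def leftFactor {I : ℕ} (x : BVec (I + I)) : BVec I := fun i => x (Fin.castAdd I i)

def rightFactor {I : ℕ} (x : BVec (I + I)) : BVec I := fun i => x (Fin.natAdd I i)

/-- The bits of the product of the two factors. -/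
def productBits {I : ℕ} (x : BVec (I + I)) (k : Fin (2 * I)) : Bool :=
  (binVal (leftFactor x) * binVal (rightFactor x)).testBit k

theorem productBits_eq_iff {I : ℕ} (x : BVec (I + I)) (φ : BVec (2 * I)) :
    productBits x = φ ↔ binVal φ = binVal (leftFactor x) * binVal (rightFactor x) := by
  refine testBit_eq_iff_binVal ?_ φ
  rw [two_mul, pow_add]
  exact Nat.mul_lt_mul'' (binVal_lt _) (binVal_lt _)

theorem cast_binVal {n : ℕ} (a : BVec n) :
    (binVal a : ℝ) = ∑ i : Fin n, ((a i).toNat : ℝ) * 2 ^ (i : ℕ) := by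
  simp [binVal]

open MulVar in
-- The equations determine every continuous variable from the input and the features, so the system
-- is solvable exactly when the features are binary digits of the product. Those digits are unique
-- (`productBits_eq_iff`).
theorem isFeatureSystem_mulSystem (I : ℕ) : IsFeatureSystem (mulSystem I) productBits := by
  intro x φ
  rw [productBits_eq_iff]
  set a := leftFactor x
  set b := rightFactor x
  have hp : (0 : ℝ) < 2 ^ I := by positivity
  have hb0 : (0 : ℝ) ≤ binVal b / 2 ^ I := by positivity
  -- The scaling of the register keeps the second factor in `[0, 1]`, as `productConstraints_hold`
  -- requires.
  have hb1 : (binVal b : ℝ) / 2 ^ I ≤ 1 := by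
    rw [div_le_one hp]
    exact_mod_cast (binVal_lt b).le
  have hfactor : ∀ v : V I → ℝ, (∀ i, v (right i) = ((b i).toNat : ℝ)) →
      (∀ c ∈ shiftConstraints factor right, c.Holds v) →
      v (factor (Fin.last I)) = binVal b / 2 ^ I := by
    intro v hv h
    rw [shiftConstraints_hold] at h
    rw [eq_div_iff hp.ne', shift_last (s := fun k => v (factor k)) h.1 h.2, cast_binVal]
    simp only [hv]
  have hacc : ∀ v : V I → ℝ, (∀ i, v (partialProduct i) = (a i).toNat * (binVal b / 2 ^ I)) →
      (∀ c ∈ shiftConstraints accumulator partialProduct, c.Holds v) →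
      v (accumulator (Fin.last I)) * 2 ^ (2 * I) = binVal a * binVal b := by
    intro v hv h
    rw [shiftConstraints_hold] at h
    have h1 := shift_last (s := fun k => v (accumulator k)) h.1 h.2
    have h2 : ∑ i : Fin I, v (partialProduct i) * 2 ^ (i : ℕ) = binVal a * (binVal b / 2 ^ I) := by
      rw [cast_binVal a, Finset.sum_mul]
      exact Finset.sum_congr rfl fun i _ => by rw [hv]; ring
    rw [h2] at h1
    rw [two_mul, pow_add, ← mul_assoc, h1]
    field_simp
  have hres : ∀ v : V I → ℝ, (∀ i, v (bit i) = ((φ i).toNat : ℝ)) →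
      (∀ c ∈ shiftConstraints result bit, c.Holds v) →
      v (result (Fin.last (2 * I))) * 2 ^ (2 * I) = binVal φ := by
    intro v hv h
    rw [shiftConstraints_hold] at h
    rw [shift_last (s := fun k => v (result k)) h.1 h.2, cast_binVal]
    simp only [hv]
  have hsplit : ∀ ζ : MulVar I → ℝ, (∀ c ∈ mulSystem I, c.Holds (assign φ ζ x)) ↔
      (∀ c ∈ shiftConstraints factor right, c.Holds (assign φ ζ x)) ∧
      (∀ i : Fin I, ∀ c ∈ productConstraints (partialProduct i) (left i) (factor (Fin.last I)),
        c.Holds (assign φ ζ x)) ∧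
      (∀ c ∈ shiftConstraints accumulator partialProduct, c.Holds (assign φ ζ x)) ∧
      (∀ c ∈ shiftConstraints result bit, c.Holds (assign φ ζ x)) ∧
      assign φ ζ x (result (Fin.last (2 * I))) = assign φ ζ x (accumulator (Fin.last I)) := by
    intro ζ
    simp only [mulSystem, List.forall_mem_append, List.forall_mem_flatMap, List.mem_finRange,
      forall_true_left, zeroConstraints_hold, List.map_cons, List.map_nil, List.sum_cons,
      List.sum_nil, and_assoc]
    refine and_congr_right' (and_congr_right' (and_congr_right' (and_congr_right' ?_)))
    push_cast
    constructor <;> intro h <;> linarith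
  have hprod : ∀ (ζ : MulVar I → ℝ) (i : Fin I),
      assign φ ζ x (factor (Fin.last I)) = binVal b / 2 ^ I →
      ((∀ c ∈ productConstraints (partialProduct i) (left i) (factor (Fin.last I)),
        c.Holds (assign φ ζ x)) ↔
        assign φ ζ x (partialProduct i) = (a i).toNat * (binVal b / 2 ^ I)) := by
    intro ζ i h
    have h' := productConstraints_hold (v := assign φ ζ x) (z := partialProduct i) (a := left i)
      (y := factor (Fin.last I)) (a i) rfl
    rw [h] at h'
    exact h' hb0 hb1
  simp only [hsplit]
  constructor
  · intro h
    obtain ⟨s, hs0, hs⟩ := exists_shift fun i => ((b i).toNat : ℝ)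
    obtain ⟨t, ht0, ht⟩ := exists_shift fun i => ((a i).toNat : ℝ) * (binVal b / 2 ^ I)
    obtain ⟨r, hr0, hr⟩ := exists_shift fun i => ((φ i).toNat : ℝ)
    let ζ : MulVar I → ℝ := Sum.elim (Sum.elim s fun i => ((a i).toNat : ℝ) * (binVal b / 2 ^ I))
      (Sum.elim t r)
    have h1 : ∀ c ∈ shiftConstraints factor right, c.Holds (assign φ ζ x) :=
      shiftConstraints_hold.2 ⟨hs0, hs⟩
    have h3 : ∀ c ∈ shiftConstraints accumulator partialProduct, c.Holds (assign φ ζ x) :=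
      shiftConstraints_hold.2 ⟨ht0, ht⟩
    have h4 : ∀ c ∈ shiftConstraints result bit, c.Holds (assign φ ζ x) :=
      shiftConstraints_hold.2 ⟨hr0, hr⟩
    have hlast := hfactor _ (fun i => rfl) h1
    refine ⟨ζ, h1, fun i => (hprod ζ i hlast).2 rfl, h3, h4, ?_⟩
    · have e1 := hacc _ (fun i => rfl) h3
      have e2 := hres _ (fun i => rfl) h4
      refine mul_right_cancel₀ (b := (2 : ℝ) ^ (2 * I)) (by positivity) ?_
      rw [e1, e2, h]
      push_cast
      rfl
  · rintro ⟨ζ, h1, h2, h3, h4, h5⟩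
    have hlast := hfactor _ (fun i => rfl) h1
    have e1 := hacc _ (fun i => (hprod ζ i hlast).1 (h2 i)) h3
    have e2 := hres _ (fun i => rfl) h4
    rw [← h5, e2] at e1
    exact_mod_cast e1

theorem totalCost_mulSystem_le (I : ℕ) : totalCost (mulSystem I) ≤ 53 * I + 18 := by
  have h := totalCost_flatMap_le (List.finRange I) (fun i : Fin I =>
    productConstraints (MulVar.partialProduct i) (MulVar.left i) (MulVar.factor (Fin.last I))) 13
      fun i _ => by simp [productConstraints, totalCost, Constraint.cost]
  rw [List.length_finRange] at h
  have h1 := totalCost_shiftConstraints_le (MulVar.factor (I := I)) MulVar.right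
  have h2 := totalCost_shiftConstraints_le (MulVar.accumulator (I := I)) MulVar.partialProduct
  have h3 := totalCost_shiftConstraints_le (MulVar.result (I := I)) MulVar.bit
  have h4 : totalCost (zeroConstraints [(1, MulVar.result (Fin.last (2 * I))),
      (-1, MulVar.accumulator (Fin.last I))]) = 6 := by
    simp [zeroConstraints, totalCost, Constraint.cost]
  simp only [mulSystem, totalCost_append]
  lia

theorem mulBit_eq_productBits {I : ℕ} (k : Fin (2 * I)) (x : BVec (I + I)) :
    mulBit I k x = if productBits x k = true then 1 else 0 := rfl

theorem card_mulVar (I : ℕ) : Fintype.card (MulVar I) = 5 * I + 3 := by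
  simp only [Fintype.card_sum, Fintype.card_fin]
  ring

theorem exists_mulBit_rep {I k : ℕ} (hI : 1 ≤ I) (hk : k < 2 * I) :
    ∃ R : MILPFeatureRep (I + I), R.Represents (mulBit I k) ∧ R.size ≤ 100 * I := by
  obtain ⟨R, hR, -, hs⟩ := (isFeatureSystem_mulSystem I).exists_rep {⟨k, hk⟩}
    (fun φ => if φ ⟨k, hk⟩ = true then 1 else 0) (fun φ' φ'' h => by simp [h])
  refine ⟨R, fun x => (hR x).trans (mulBit_eq_productBits ⟨k, hk⟩ x).symm, hs.trans ?_⟩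
  have := totalCost_mulSystem_le I
  rw [card_mulVar, Fintype.card_fin, Finset.card_singleton]
  lia

/-- A middle bit of the product and the parity of the input, in one function. -/
def mulParity (I : ℕ) (x : BVec (I + I)) : ℝ := mulBit I (I - 1) x + 2 * parity (I + I) x

/-- The two systems are placed side by side and `ρ` reads one feature of each. The bound `I ≤
R.size` makes the representations arbitrarily large. -/
theorem exists_mulParity_rep {I : ℕ} (hI : 1 ≤ I) :
    ∃ R : MILPFeatureRep (I + I), R.Represents (mulParity I) ∧ I ≤ R.size ∧
      R.size ≤ 200 * I := by
  have hk : I - 1 < 2 * I := by lia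
  obtain ⟨R, hR, hc, hs⟩ :=
    ((isFeatureSystem_mulSystem I).join (isFeatureSystem_paritySystem (I + I))).exists_rep
    {.inl ⟨I - 1, hk⟩, .inr (Fin.last (I + I))}
    (fun φ => (if φ (.inl ⟨I - 1, hk⟩) = true then 1 else 0)
      + 2 * if φ (.inr (Fin.last (I + I))) = true then 0 else 1) (fun φ' φ'' h => by simp [h])
  refine ⟨R, fun x => (hR x).trans ?_, ?_, hs.trans ?_⟩
  · rw [mulParity, parity_eq_oddPrefix, mulBit_eq_productBits ⟨I - 1, hk⟩]
    rfl
  · simp only [Fintype.card_sum, Fintype.card_fin] at hc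
    lia
  · have h1 := totalCost_mulSystem_le I
    have h2 := totalCost_paritySystem_le (I + I)
    rw [totalCost_joinSystems, Finset.card_pair (by simp), Fintype.card_sum, Fintype.card_sum,
      card_mulVar, Fintype.card_fin, Fintype.card_fin, Fintype.card_empty]
    lia

/-! ### Lower bounds for trees and rule systems -/

/-- If every change of a single component changes `f`, then no two inputs share a rule. -/
theorem two_pow_le_card_of_rules {I : ℕ} {Λ : Type} [Fintype Λ] {A : Λ → Finset (Fin I × Bool)}
    {val : Λ → ℝ} (hA : ∀ x : BVec I, ∃! r, ∀ p ∈ A r, x p.1 = p.2) {f : BVec I → ℝ}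
    (hf : ∀ r x, (∀ p ∈ A r, x p.1 = p.2) → f x = val r)
    (hflip : ∀ x i, f (Function.update x i (!x i)) ≠ f x) : 2 ^ I ≤ Fintype.card Λ := by
  choose rule hrule _ using hA
  have hinj : Function.Injective rule := by
    intro x y hxy
    by_contra hne
    obtain ⟨i, hi⟩ := Function.ne_iff.1 hne
    refine hflip x i ?_
    rw [hf _ _ (hrule x)]
    refine hf _ _ fun p hp => ?_
    have h1 := hrule x p hp
    have h2 := hrule y p (hxy ▸ hp)
    -- The common antecedent cannot mention `i`, where `x` and `y` disagree, so it survives the flip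
    -- of `x` at `i`.
    by_cases h : p.1 = i
    · subst h
      exact absurd (h1.trans h2.symm) hi
    · rw [Function.update_of_ne h, h1]
  simpa using Fintype.card_le_of_injective rule hinj

theorem parity_flip {I : ℕ} (x : BVec I) (i : Fin I) :
    parity I (Function.update x i (!x i)) ≠ parity I x := by
  have h : ∑ j ∈ {i}ᶜ, (Function.update x i (!x i) j).toNat = ∑ j ∈ {i}ᶜ, (x j).toNat :=
    Finset.sum_congr rfl fun j hj => by
      rw [Function.update_of_ne (by simpa using hj)]
  simp only [parity, Fintype.sum_eq_add_sum_compl i, h, Function.update_self]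
  cases x i <;> by_cases h' : Even (∑ j ∈ {i}ᶜ, (x j).toNat) <;>
    simp [h', Nat.even_add, Nat.not_even_one]

theorem DecisionTree.two_pow_le_size {I : ℕ} {f : BVec I → ℝ} (T : DecisionTree I)
    (hT : T.Represents f) (hflip : ∀ x i, f (Function.update x i (!x i)) ≠ f x) :
    2 ^ I ≤ T.size := by
  obtain ⟨Λ, _, A, val, hA, hv, hc, -⟩ := T.exists_rules
  exact (two_pow_le_card_of_rules hA (fun r x h => (hT x).symm.trans (hv r x h)) hflip).trans hc

theorem RuleSystem.two_pow_le_size {I : ℕ} {f : BVec I → ℝ} (S : RuleSystem I)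
    (hS : S.Represents f) (hflip : ∀ x i, f (Function.update x i (!x i)) ≠ f x) :
    2 ^ I ≤ S.size := by
  refine (two_pow_le_card_of_rules S.existsUnique_rule hS hflip).trans ?_
  simpa using S.numRules_le_size

/-! ### Lower bounds for algebraic decision diagrams -/

namespace ADD

variable {I : ℕ} (D : ADD I)

theorem reach_congr {ℓ : ℕ} {x y : BVec I} (h : ∀ i, (D.pos i : ℕ) < ℓ → x i = y i)
    (u : Fin D.numNodes) : D.reach ℓ x u = D.reach ℓ y u := by
  induction u using D.node_induction with
  | terminal u c hu => rw [D.reach_terminal hu, D.reach_terminal hu]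
  | decision u i hi lo hu ih1 ih2 =>
    rw [D.reach_decision hu, D.reach_decision hu, ih1, ih2]
    split_ifs with h1 h2 h3 h3
    · rfl
    · exact absurd (h i h1 ▸ h2) h3
    · exact absurd ((h i h1).symm ▸ h3) h2
    · rfl
    · rfl

/-- Together with `reach_congr` this cuts an evaluation at level `ℓ`: the components before `ℓ` only
select a node, and the later ones only evaluate from it. -/
theorem evalAt_congr {ℓ : ℕ} {x y : BVec I} (h : ∀ i, ℓ ≤ (D.pos i : ℕ) → x i = y i)
    (u : Fin D.numNodes) (hu : ℓ ≤ (D.node u).level D.pos) : D.evalAt x u = D.evalAt y u := by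
  induction u using D.node_induction with
  | terminal u c hc => rw [D.evalAt_terminal hc, D.evalAt_terminal hc]
  | decision u i hi lo hd ih1 ih2 =>
    have ho := D.ordered u i hi lo hd
    rw [hd] at hu
    rw [D.evalAt_decision hd, D.evalAt_decision hd, h i hu, ih1 (hu.trans ho.1.le),
      ih2 (hu.trans ho.2.le)]

/-- Inputs whose first `ℓ` components in the order of the diagram define different subfunctions
lead to different nodes. -/
theorem card_le_size_of_fooling {f : BVec I → ℝ} (hD : D.Represents f) {ℓ : ℕ} (hℓ : ℓ ≤ I)
    {ι : Type} [Fintype ι] (y : ι → BVec I)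
    (h : ∀ s t, s ≠ t → ∃ z : BVec I, f (fun i => if (D.pos i : ℕ) < ℓ then y s i else z i) ≠
      f (fun i => if (D.pos i : ℕ) < ℓ then y t i else z i)) :
    Fintype.card ι ≤ D.size := by
  have hinj : Function.Injective fun s => D.reach ℓ (y s) D.root := by
    intro s t hst
    by_contra hne
    obtain ⟨z, hz⟩ := h s t hne
    have key : ∀ r, f (fun i => if (D.pos i : ℕ) < ℓ then y r i else z i)
        = D.evalAt z (D.reach ℓ (y r) D.root) := by
      intro r
      rw [← hD, eval, ← D.evalAt_reach ℓ,
        D.reach_congr (y := y r) (fun i hi => by simp only [hi, if_true])]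
      exact D.evalAt_congr (fun i hi => by simp only [not_lt.2 hi, if_false]) _
        (D.le_level_reach hℓ _ _)
    exact hz ((key s).trans ((congrArg (D.evalAt z) hst).trans (key t).symm))
  simpa [size] using Fintype.card_le_of_injective _ hinj

end ADD

/-! ### The middle bit of multiplication -/

/-- The product is `2 ^ (e + p) (A + 2 ^ d (A + B) + 2 ^ (2 d) B)`. As `w < d`, neither outer
summand disturbs bit `w` of `A + B`, and this bit is the carry because `A + B < 2 ^ (w + 1)`. -/
theorem testBit_shifted_product {e d w p A B : ℕ} (hw : w < d) (hA : A < 2 ^ w) (hB : B < 2 ^ w) :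
    ((2 ^ e * (A + 2 ^ d * B)) * (2 ^ p + 2 ^ (p + d))).testBit (e + p + d + w)
      = decide (2 ^ w ≤ A + B) := by
  have hwd : 2 ^ (w + 1) ≤ 2 ^ d := Nat.pow_le_pow_right two_pos hw
  rw [pow_succ] at hwd
  have h1 : (2 ^ e * (A + 2 ^ d * B)) * (2 ^ p + 2 ^ (p + d))
      = 2 ^ (e + p) * (2 ^ d * (2 ^ d * B + (A + B)) + A) := by
    simp only [pow_add]
    ring
  rw [h1, Nat.testBit_two_pow_mul, Nat.testBit_two_pow_mul_add _ (by lia), if_neg (by lia),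
    Nat.testBit_two_pow_mul_add _ (by lia), if_pos (by lia)]
  have e1 : e + p + d + w - (e + p) - d = w := by lia
  have e2 : e + p + d + w ≥ e + p := by lia
  rw [e1, decide_eq_true e2, Bool.true_and]
  by_cases h : 2 ^ w ≤ A + B
  · rw [decide_eq_true h]
    exact Nat.testBit_of_two_pow_le_and_two_pow_add_one_gt h (by rw [pow_succ]; lia)
  · rw [decide_eq_false h]
    exact Nat.testBit_lt_two_pow (not_le.1 h)

theorem sum_range_toNat_lt (g : ℕ → Bool) (w : ℕ) :
    ∑ k ∈ Finset.range w, (g k).toNat * 2 ^ k < 2 ^ w := by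
  induction w with
  | zero => simp
  | succ w ih =>
    rw [Finset.sum_range_succ, pow_succ]
    cases g w <;> simp <;> lia

/-- A number whose digits vanish outside two windows of length `w` at distance `d`. -/
theorem sum_two_windows {n e d w : ℕ} (hw : w < d) (hn : e + d + w ≤ n) (g : ℕ → Bool)
    (hg : ∀ m, ¬(e ≤ m ∧ m < e + w) → ¬(e + d ≤ m ∧ m < e + d + w) → g m = false) :
    ∑ m ∈ Finset.range n, (g m).toNat * 2 ^ m =
      2 ^ e * (∑ k ∈ Finset.range w, (g (e + k)).toNat * 2 ^ k
        + 2 ^ d * ∑ k ∈ Finset.range w, (g (e + d + k)).toNat * 2 ^ k) := by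
  obtain ⟨c, rfl⟩ := Nat.exists_eq_add_of_le hw.le
  obtain ⟨r, rfl⟩ := Nat.exists_eq_add_of_le hn
  have h1 : ∑ k ∈ Finset.range e, (g k).toNat * 2 ^ k = 0 :=
    Finset.sum_eq_zero fun k hk => by
      rw [Finset.mem_range] at hk
      rw [hg k (by lia) (by lia), Bool.toNat_false, zero_mul]
  have h2 : ∑ k ∈ Finset.range c, (g (e + w + k)).toNat * 2 ^ (e + w + k) = 0 :=
    Finset.sum_eq_zero fun k hk => by
      rw [Finset.mem_range] at hk
      rw [hg _ (by lia) (by lia), Bool.toNat_false, zero_mul]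
  have h3 : ∑ k ∈ Finset.range r, (g (e + (w + c) + w + k)).toNat * 2 ^ (e + (w + c) + w + k) = 0 :=
    Finset.sum_eq_zero fun k _ => by
      rw [hg _ (by lia) (by lia), Bool.toNat_false, zero_mul]
  rw [Finset.sum_range_add, h3, Finset.sum_range_add, ← add_assoc e w c, Finset.sum_range_add, h2,
    Finset.sum_range_add, h1, mul_add, Finset.mul_sum, Finset.mul_sum,
    Finset.mul_sum, zero_add, add_zero, add_zero]
  congr 1 <;> refine Finset.sum_congr rfl fun k _ => ?_ <;> simp only [pow_add] <;> ring

/-- A threshold below which a given number of the values of an injective function lie. -/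
theorem exists_card_filter_lt_eq {S : Finset ℕ} {P : ℕ → ℕ} (hP : Set.InjOn P S) {N : ℕ} {g : ℕ}
    (hg : g ≤ (S.filter fun i => P i < N).card) :
    ∃ ℓ ≤ N, (S.filter fun i => P i < ℓ).card = g := by
  induction N with
  | zero => exact ⟨0, le_rfl, by simpa using hg.antisymm' (by simp)⟩
  | succ N ih =>
    by_cases h : g ≤ (S.filter fun i => P i < N).card
    · obtain ⟨ℓ, hℓ, h'⟩ := ih h
      exact ⟨ℓ, by lia, h'⟩
    · refine ⟨N + 1, le_rfl, le_antisymm ?_ hg⟩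
      -- By injectivity the count grows by at most one when the threshold does, so it skips no
      -- value.
      have h1 : (S.filter fun i => P i = N).card ≤ 1 := by
        refine Finset.card_le_one.2 fun a ha b hb => ?_
        rw [Finset.mem_filter] at ha hb
        exact hP ha.1 hb.1 (ha.2.trans hb.2.symm)
      have h2 : S.filter (fun i => P i < N + 1)
          ⊆ S.filter (fun i => P i < N) ∪ S.filter fun i => P i = N := by
        intro i
        simp only [Finset.mem_filter, Finset.mem_union]
        lia
      have h3 := (Finset.card_le_card h2).trans (Finset.card_union_le _ _)
      lia

/-- If `top` holds for exactly half of the first `4 q` indices, then many pairs of indices at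
some common distance `d` are separated by `top`. -/
theorem exists_split_shift (top : ℕ → Prop) [DecidablePred top] {q n : ℕ} (hn : 8 * q + 2 ≤ n)
    (htop : ((Finset.range (4 * q)).filter top).card = 2 * q) :
    ∃ e d w, w < d ∧ e + d + w + 1 ≤ n ∧
      q ≤ ((Finset.range w).filter fun k => ¬(top (e + k) ↔ top (e + d + k))).card := by
  rcases Nat.eq_zero_or_pos q with rfl | hq
  · exact ⟨0, 1, 0, by lia, by lia, by simp⟩
  set h := 4 * q with hh
  -- Pairs of an index `i < h` and an index `h + 1 + j` that `top` separates. As `top` holds for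
  -- half of the `i`, each `j` has exactly `2 q` partners, whatever its own status.
  let X := (Finset.range h ×ˢ Finset.range h).filter fun p => ¬(top p.2 ↔ top (h + 1 + p.1))
  have hinner : ∀ j, ((Finset.range h).filter fun i => ¬(top i ↔ top (h + 1 + j))).card = 2 * q := by
    intro j
    by_cases hj : top (h + 1 + j)
    · have := Finset.card_filter_add_card_filter_not (s := Finset.range h) top
      simp only [hj, iff_true]
      rw [Finset.card_range] at this
      lia
    · simpa only [hj, iff_false, not_not] using htop
  have hX : X.card = h * (2 * q) := by
    simp only [X, Finset.card_filter, Finset.sum_product]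
    simp only [← Finset.card_filter, hinner, Finset.sum_const, Finset.card_range, smul_eq_mul]
  -- The `h * (2 * q)` separated pairs have at most `2 h` differences, so some difference occurs at
  -- least `q` times.
  obtain ⟨y, hy, hfib⟩ := Finset.exists_le_card_fiber_of_mul_le_card_of_maps_to
    (s := X) (t := Finset.range (2 * h)) (f := fun p => p.1 + h - p.2) (n := q)
    (fun p hp => by
      simp only [X, Finset.mem_filter, Finset.mem_product, Finset.mem_range] at hp ⊢
      lia) ⟨0, by simp; lia⟩ (by rw [hX, Finset.card_range, hh]; nlinarith)
  rw [Finset.mem_range] at hy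
  -- The distance is `h + 1 + j - i = y + 1`, and the window contains all `i < h` whose partner at
  -- this distance has `j < h`. The gap of one index between the two blocks gives `w < d`; the
  -- truncated `h - y` also covers `y > h`.
  refine ⟨h - y, y + 1, min h (2 * h - y) - (h - y), by lia, by lia, hfib.trans ?_⟩
  refine Finset.card_le_card_of_injOn (fun p => p.2 - (h - y)) ?_ ?_
  · rintro ⟨j, i⟩ hp
    simp only [X, Finset.coe_filter, Finset.mem_filter, Finset.mem_product, Finset.mem_range,
      Set.mem_ofPred_eq] at hp ⊢
    obtain ⟨⟨⟨hj, hi⟩, hs⟩, hd⟩ := hp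
    refine ⟨by lia, ?_⟩
    have e1 : h - y + (i - (h - y)) = i := by lia
    have e2 : h - y + (y + 1) + (i - (h - y)) = h + 1 + j := by lia
    rwa [e1, e2]
  · rintro ⟨j, i⟩ hp ⟨j', i'⟩ hp' heq
    simp only [X, Finset.coe_filter, Finset.mem_filter, Finset.mem_product, Finset.mem_range,
      Set.mem_ofPred_eq] at hp hp' heq
    ext <;> simp only <;> lia

/-- The digits of the first factor in the fooling set: the digits `s` at both positions of each
pair in `J`, and `0` and `1` at the positions of the other pairs. -/
def foolingDigit (e d w : ℕ) (J s : Finset ℕ) (m : ℕ) : Bool :=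
  if e ≤ m ∧ m < e + w then decide (m - e ∈ s)
  else if e + d ≤ m ∧ m < e + d + w then decide (m - (e + d) ∈ s ∨ m - (e + d) ∉ J)
  else false

theorem sum_pow_eq_sum_range {w : ℕ} {s : Finset ℕ} (hs : s ⊆ Finset.range w) :
    ∑ k ∈ s, 2 ^ k = ∑ k ∈ Finset.range w, (if k ∈ s then 1 else 0) * 2 ^ k := by
  simp only [ite_mul, one_mul, zero_mul, Finset.sum_ite_mem, Finset.inter_eq_right.2 hs]

/-- Comparison of the digits of `s`, seen above the threshold of the order, with those of `s₀`,
whose complement is seen below it. -/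
theorem testBit_fooling {n e d w : ℕ} (hw : w < d) (hn : e + d + w + 1 ≤ n) (top : ℕ → Prop)
    [DecidablePred top] {J s s₀ : Finset ℕ}
    (hJ : J = (Finset.range w).filter fun k => ¬(top (e + k) ↔ top (e + d + k)))
    (hs : s ⊆ J) (hs₀ : s₀ ⊆ J) :
    ((∑ m ∈ Finset.range n, (if top m then foolingDigit e d w J s m
        else foolingDigit e d w J (J \ s₀) m).toNat * 2 ^ m)
      * (2 ^ (n - 1 - (e + d + w)) + 2 ^ (n - 1 - (e + d + w) + d))).testBit (n - 1)
      = decide (∑ k ∈ s₀, 2 ^ k < ∑ k ∈ s, 2 ^ k) := by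
  have hJw : J ⊆ Finset.range w := hJ ▸ Finset.filter_subset _ _
  rw [sum_two_windows (e := e) hw (by lia) (fun m => if top m then foolingDigit e d w J s m
        else foolingDigit e d w J (J \ s₀) m)
    (fun m h1 h2 => by simp only [foolingDigit, if_neg h1, if_neg h2, ite_self])]
  set g := fun m => if top m then foolingDigit e d w J s m
    else foolingDigit e d w J (J \ s₀) m with hg
  have hA := sum_range_toNat_lt (fun k => g (e + k)) w
  have hB := sum_range_toNat_lt (fun k => g (e + d + k)) w
  have hbit : e + (n - 1 - (e + d + w)) + d + w = n - 1 := by lia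
  have hprod := testBit_shifted_product (e := e) (p := n - 1 - (e + d + w)) hw hA hB
  rw [hbit] at hprod
  rw [hprod]
  -- The two digits at offset `k` sum to `1 + [k ∈ s] - [k ∈ s₀]`. For `k ∈ J` one digit comes from
  -- `s` and the other from `J \ s₀`; for `k ∉ J` they are `0` and `1`.
  have hsum : (∑ k ∈ Finset.range w, (g (e + k)).toNat * 2 ^ k
      + ∑ k ∈ Finset.range w, (g (e + d + k)).toNat * 2 ^ k) + ∑ k ∈ s₀, 2 ^ k
      = ∑ k ∈ Finset.range w, 2 ^ k + ∑ k ∈ s, 2 ^ k := by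
    rw [sum_pow_eq_sum_range (hs.trans hJw), sum_pow_eq_sum_range (hs₀.trans hJw),
      ← Finset.sum_add_distrib, ← Finset.sum_add_distrib, ← Finset.sum_add_distrib]
    refine Finset.sum_congr rfl fun k hk => ?_
    rw [Finset.mem_range] at hk
    rw [← add_mul, ← add_mul, ← one_add_mul]
    congr 1
    have f1 : ∀ r, foolingDigit e d w J r (e + k) = decide (k ∈ r) := fun r => by
      rw [foolingDigit, if_pos (by lia), Nat.add_sub_cancel_left]
    have f2 : ∀ r, foolingDigit e d w J r (e + d + k) = decide (k ∈ r ∨ k ∉ J) := fun r => by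
      rw [foolingDigit, if_neg (by lia), if_pos (by lia), Nat.add_sub_cancel_left]
    simp only [hg, f1, f2, Finset.mem_sdiff]
    have hkJ : k ∈ J ↔ ¬(top (e + k) ↔ top (e + d + k)) := by simp [hJ, hk]
    have m1 := @hs k
    have m2 := @hs₀ k
    by_cases t1 : top (e + k) <;> by_cases t2 : top (e + d + k) <;> by_cases k1 : k ∈ s <;>
      by_cases k2 : k ∈ s₀ <;> simp_all
  have hgeom : ∑ k ∈ Finset.range w, 2 ^ k + 1 = 2 ^ w := by
    have := Nat.geomSum_eq (le_refl 2) w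
    have := Nat.one_le_two_pow (n := w)
    lia
  -- Now `A + B = 2 ^ w - 1 + ∑ s - ∑ s₀`, so a carry occurs exactly when the sum over `s` exceeds
  -- that over `s₀`.
  rw [decide_eq_decide]
  lia

/-- The digits of the second factor in the fooling set. -/
def twoDigits (p d : ℕ) (m : ℕ) : Bool := decide (m = p ∨ m = p + d)

theorem sum_twoDigits {n p d : ℕ} (hd : 0 < d) (hn : p + d < n) :
    ∑ m ∈ Finset.range n, (twoDigits p d m).toNat * 2 ^ m = 2 ^ p + 2 ^ (p + d) := by
  have h : ∀ m, (twoDigits p d m).toNat * 2 ^ m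
      = (if m = p then 2 ^ m else 0) + if m = p + d then 2 ^ m else 0 := by
    intro m
    by_cases h1 : m = p
    · simp [twoDigits, h1, hd.ne']
    · by_cases h2 : m = p + d <;> simp [twoDigits, h1, h2, hd.ne']
  simp only [h, Finset.sum_add_distrib, Finset.sum_ite_eq', Finset.mem_range]
  rw [if_pos (by lia), if_pos hn]

theorem binVal_digits {n : ℕ} (g : ℕ → Bool) :
    binVal (fun i : Fin n => g i) = ∑ m ∈ Finset.range n, (g m).toNat * 2 ^ m :=
  (Finset.sum_range fun m => (g m).toNat * 2 ^ m).symm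

/-- A diagram for a function that determines the middle bit of the product is large. -/
theorem ADD.two_pow_le_size_of_mulBit {n q : ℕ} (hn : 8 * q + 2 ≤ n) {f : BVec (n + n) → ℝ}
    (hf : ∀ x y, f x = f y → mulBit n (n - 1) x = mulBit n (n - 1) y) (D : ADD (n + n))
    (hD : D.Represents f) : 2 ^ q ≤ D.size := by
  let P : ℕ → ℕ := fun i => if hi : i < n then D.pos (Fin.castAdd n ⟨i, hi⟩) else n + n
  have hP : ∀ i : Fin n, P i = D.pos (Fin.castAdd n i) := fun i => dif_pos i.isLt
  have hPinj : Set.InjOn P (Finset.range (4 * q)) := by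
    intro i hi j hj hij
    simp only [Finset.coe_range, Set.mem_Iio] at hi hj
    have h1 := hP ⟨i, by lia⟩
    have h2 := hP ⟨j, by lia⟩
    simp only at h1 h2
    rw [h1, h2] at hij
    have := Fin.castAdd_injective n n (D.pos.injective (Fin.ext hij))
    simpa using this
  have hcount : 2 * q ≤ ((Finset.range (4 * q)).filter fun i => P i < n + n).card := by
    rw [Finset.filter_true_of_mem, Finset.card_range]
    · lia
    · intro i hi
      rw [Finset.mem_range] at hi
      exact (hP ⟨i, by lia⟩).trans_lt (Fin.isLt _)
  obtain ⟨ℓ, hℓ, htop⟩ := exists_card_filter_lt_eq hPinj hcount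
  obtain ⟨e, d, w, hw, hedw, hq⟩ := exists_split_shift (fun i => P i < ℓ) hn htop
  set J := (Finset.range w).filter fun k => ¬(P (e + k) < ℓ ↔ P (e + d + k) < ℓ) with hJ
  let p := n - 1 - (e + d + w)
  -- The second factor is the same for all `s`, so it is irrelevant on which side of the cut its
  -- digits lie.
  let y : Finset ℕ → BVec (n + n) := fun s =>
    Fin.append (fun i => foolingDigit e d w J s i) (fun i => twoDigits p d i)
  have key : ∀ s ⊆ J, ∀ s₀ ⊆ J,
      mulBit n (n - 1) (fun i => if (D.pos i : ℕ) < ℓ then y s i else y (J \ s₀) i)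
        = if ∑ k ∈ s₀, 2 ^ k < ∑ k ∈ s, 2 ^ k then 1 else 0 := by
    intro s hs s₀ hs₀
    have h := testBit_fooling hw hedw (fun i => P i < ℓ) hJ hs hs₀
    rw [← sum_twoDigits (n := n) (by lia) (by lia), ← binVal_digits, ← binVal_digits] at h
    simp only [mulBit, y, Fin.append_left, Fin.append_right, ite_self, ← hP, p]
    rw [h]
    simp only [decide_eq_true_eq]
  have hfool := D.card_le_size_of_fooling hD hℓ (ι := J.powerset) (fun s => y s) ?_
  · rw [Fintype.card_coe, Finset.card_powerset] at hfool
    exact (Nat.pow_le_pow_right two_pos hq).trans hfool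
  · rintro ⟨s, hs⟩ ⟨t, ht⟩ hst
    rw [Finset.mem_powerset] at hs ht
    have hV : ∑ k ∈ s, 2 ^ k ≠ ∑ k ∈ t, 2 ^ k := fun h =>
      hst (Subtype.ext (Finset.geomSum_injective le_rfl h))
    rcases lt_or_gt_of_ne hV with hlt | hlt
    -- The set with the smaller sum serves as reference: the comparison is strict, so it fails for
    -- that set and holds for the other.
    · refine ⟨y (J \ s), fun h => ?_⟩
      have := hf _ _ h
      rw [key s hs s hs, key t ht s hs, if_pos hlt, if_neg (lt_irrefl _)] at this
      exact zero_ne_one this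
    · refine ⟨y (J \ t), fun h => ?_⟩
      have := hf _ _ h
      rw [key s hs t ht, key t ht t ht, if_pos hlt, if_neg (lt_irrefl _)] at this
      exact one_ne_zero this

/-- The middle bit of the product is not constant. -/
theorem exists_mulBit_ne {n : ℕ} (hn : 1 ≤ n) :
    ∃ x y, mulBit n (n - 1) x ≠ mulBit n (n - 1) y := by
  refine ⟨Fin.append (fun i => decide ((i : ℕ) = n - 1)) (fun i => decide ((i : ℕ) = 0)),
    fun _ => false, ?_⟩
  have h : ∀ k < n, binVal (fun i : Fin n => decide ((i : ℕ) = k)) = 2 ^ k := by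
    intro k hk
    rw [binVal_digits fun m => decide (m = k), Finset.sum_eq_single k]
    · simp
    · intro m _ hm
      simp [hm]
    · intro h
      simp [hk] at h
  simp only [mulBit, Fin.append_left, Fin.append_right]
  rw [h _ (by lia), h 0 (by lia)]
  simp [binVal, Nat.testBit_two_pow_self]

theorem ADD.two_le_size {I : ℕ} {f : BVec I → ℝ} (D : ADD I) (hD : D.Represents f)
    {x y : BVec I} (h : f x ≠ f y) : 2 ≤ D.size := by
  have := D.card_le_size_of_fooling hD le_rfl (ι := Bool) (fun b => if b then x else y) ?_
  · simpa using this
  · have hlt : ∀ i, (D.pos i : ℕ) < I := fun i => (D.pos i).isLt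
    intro s t hst
    refine ⟨x, ?_⟩
    cases s <;> cases t <;> simp_all [Ne.symm]

theorem ADD.rpow_le_size_of_mulBit {n : ℕ} (hn : 1 ≤ n) {f : BVec (n + n) → ℝ}
    (hf : ∀ x y, f x = f y → mulBit n (n - 1) x = mulBit n (n - 1) y) (D : ADD (n + n))
    (hD : D.Represents f) : (2 : ℝ) ^ ((1 / 20 : ℝ) * n) ≤ D.size := by
  have hk : ∀ k : ℕ, n ≤ 20 * k → 2 ^ k ≤ D.size → (2 : ℝ) ^ ((1 / 20 : ℝ) * n) ≤ D.size := by
    intro k h1 h2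
    have h1' : (n : ℝ) ≤ 20 * k := by exact_mod_cast h1
    calc (2 : ℝ) ^ ((1 / 20 : ℝ) * n) ≤ (2 : ℝ) ^ (k : ℝ) :=
          Real.rpow_le_rpow_of_exponent_le one_le_two (by linarith)
      _ = ((2 ^ k : ℕ) : ℝ) := by rw [Real.rpow_natCast]; push_cast; rfl
      _ ≤ D.size := by exact_mod_cast h2
  -- For `n ≤ 20` two nodes suffice, as the bit is not constant. For larger `n`, the choice `q = (n
  -- - 2) / 8` satisfies `n ≤ 20 q`.
  by_cases h : n ≤ 20
  · obtain ⟨x, y, hxy⟩ := exists_mulBit_ne hn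
    exact hk 1 (by lia) (D.two_le_size hD fun h' => hxy (hf _ _ h'))
  · exact hk ((n - 2) / 8) (by lia) (D.two_pow_le_size_of_mulBit (by lia) hf hD)

/-! ### The combined function -/

theorem mulBit_eq_zero_or_one (I k : ℕ) (x : BVec (I + I)) :
    mulBit I k x = 0 ∨ mulBit I k x = 1 := by
  rw [mulBit]
  split_ifs <;> simp

theorem parity_eq_zero_or_one (I : ℕ) (x : BVec I) : parity I x = 0 ∨ parity I x = 1 := by
  rw [parity]
  split_ifs <;> simp

/-- The four combinations of two values in `{0, 1}` give the distinct values `0, 1, 2, 3`, so both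
lower bounds carry over to `mulParity`. -/
theorem mulParity_eq_iff {I : ℕ} (x y : BVec (I + I)) : mulParity I x = mulParity I y ↔
    mulBit I (I - 1) x = mulBit I (I - 1) y ∧ parity (I + I) x = parity (I + I) y := by
  unfold mulParity
  rcases mulBit_eq_zero_or_one I (I - 1) x with h1 | h1 <;>
  rcases mulBit_eq_zero_or_one I (I - 1) y with h2 | h2 <;>
  rcases parity_eq_zero_or_one (I + I) x with h3 | h3 <;>
  rcases parity_eq_zero_or_one (I + I) y with h4 | h4 <;>
  rw [h1, h2, h3, h4] <;> norm_num

theorem exists_exponential_gap : ∃ δ : ℝ, 0 < δ ∧ ∀ N : ℕ,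
    ∃ (I : ℕ) (f : BVec I → ℝ) (R : MILPFeatureRep I), R.Represents f ∧ N ≤ R.size ∧
      (∀ T : DecisionTree I, T.Represents f → (2 : ℝ) ^ (δ * R.size) ≤ T.size) ∧
      (∀ D : ADD I, D.Represents f → (2 : ℝ) ^ (δ * R.size) ≤ D.size) ∧
      (∀ S : RuleSystem I, S.Represents f → (2 : ℝ) ^ (δ * R.size) ≤ S.size) := by
  -- The rate `1 / 20` of the ADD bound is divided by the factor `200` of the size bound.
  refine ⟨1 / 4000, by norm_num, fun N => ?_⟩
  have hI : 1 ≤ N + 1 := by lia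
  obtain ⟨R, hR, hN, hs⟩ := exists_mulParity_rep hI
  have hs' : (R.size : ℝ) ≤ 200 * ((N + 1 : ℕ) : ℝ) := by exact_mod_cast hs
  have hle : (2 : ℝ) ^ ((1 / 4000 : ℝ) * R.size) ≤ 2 ^ ((1 / 20 : ℝ) * ((N + 1 : ℕ) : ℝ)) :=
    Real.rpow_le_rpow_of_exponent_le one_le_two (by linarith)
  have hflip : ∀ x i, mulParity (N + 1) (Function.update x i (!x i)) ≠ mulParity (N + 1) x :=
    fun x i h => parity_flip x i ((mulParity_eq_iff _ _).1 h).2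
  have hexp : ∀ k : ℕ, 2 ^ (N + 1 + (N + 1)) ≤ k → (2 : ℝ) ^ ((1 / 4000 : ℝ) * R.size) ≤ k := by
    intro k hk
    calc (2 : ℝ) ^ ((1 / 4000 : ℝ) * R.size) ≤ 2 ^ ((1 / 20 : ℝ) * ((N + 1 : ℕ) : ℝ)) := hle
      _ ≤ (2 : ℝ) ^ ((N + 1 + (N + 1) : ℕ) : ℝ) :=
          Real.rpow_le_rpow_of_exponent_le one_le_two
            (by push_cast; linarith [Nat.cast_nonneg (α := ℝ) N])
      _ = ((2 ^ (N + 1 + (N + 1)) : ℕ) : ℝ) := by rw [Real.rpow_natCast]; push_cast; rfl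
      _ ≤ k := by exact_mod_cast hk
  exact ⟨_, mulParity (N + 1), R, hR, by lia, fun T hT => hexp _ (T.two_pow_le_size hT hflip),
    fun D hD => hle.trans (D.rpow_le_size_of_mulBit hI
      (fun x y h => ((mulParity_eq_iff x y).1 h).1) hD),
    fun S hS => hexp _ (S.two_pow_le_size hS hflip)⟩

end CSI

end

theorem mainTheorem7 :
    -- (i) polynomial-size simulation by MILP-based feature representations
    (∃ p : Polynomial ℕ, ∀ (I : ℕ) (f : CSI.BVec I → ℝ),
      (∀ T : CSI.DecisionTree I, T.Represents f →
        ∃ R : CSI.MILPFeatureRep I, R.Represents f ∧ R.size ≤ p.eval T.size) ∧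
      (∀ D : CSI.ADD I, D.Represents f →
        ∃ R : CSI.MILPFeatureRep I, R.Represents f ∧ R.size ≤ p.eval D.size) ∧
      (∀ S : CSI.RuleSystem I, S.Represents f →
        ∃ R : CSI.MILPFeatureRep I, R.Represents f ∧ R.size ≤ p.eval S.size)) ∧
    -- (ii) arbitrarily large MILP-based feature representations for which every equivalent
    -- tree, ADD and rule system is exponentially larger
    (∃ δ : ℝ, 0 < δ ∧ ∀ N : ℕ, ∃ (I : ℕ) (f : CSI.BVec I → ℝ) (R : CSI.MILPFeatureRep I),
      R.Represents f ∧ N ≤ R.size ∧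
      (∀ T : CSI.DecisionTree I, T.Represents f → (2 : ℝ) ^ (δ * R.size) ≤ T.size) ∧
      (∀ D : CSI.ADD I, D.Represents f → (2 : ℝ) ^ (δ * R.size) ≤ D.size) ∧
      (∀ S : CSI.RuleSystem I, S.Represents f → (2 : ℝ) ^ (δ * R.size) ≤ S.size)) ∧
    -- (ii), parity against trees and rule systems
    (∃ C : ℕ, ∀ I : ℕ, 1 ≤ I →
      (∃ R : CSI.MILPFeatureRep I, R.Represents (CSI.parity I) ∧ R.size ≤ C * I) ∧
      (∀ T : CSI.DecisionTree I, T.Represents (CSI.parity I) → 2 ^ I ≤ T.size) ∧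
      (∀ S : CSI.RuleSystem I, S.Represents (CSI.parity I) → 2 ^ I ≤ S.size)) ∧
    -- (ii), the bits of binary multiplication (the middle one against ADDs)
    (∃ (C : ℕ) (δ : ℝ), 0 < δ ∧ ∀ I : ℕ, 1 ≤ I →
      (∀ k < 2 * I, ∃ R : CSI.MILPFeatureRep (I + I),
        R.Represents (CSI.mulBit I k) ∧ R.size ≤ C * I) ∧
      (∀ D : CSI.ADD (I + I), D.Represents (CSI.mulBit I (I - 1)) →
        (2 : ℝ) ^ (δ * I) ≤ D.size)) := by
  refine ⟨⟨100 * Polynomial.X ^ 3, fun I f => ?_⟩, CSI.exists_exponential_gap,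
    ⟨30, fun I hI => ⟨CSI.exists_parity_rep hI, fun T hT => T.two_pow_le_size hT CSI.parity_flip,
      fun S hS => S.two_pow_le_size hS CSI.parity_flip⟩⟩,
    ⟨100, 1 / 20, by norm_num, fun I hI => ⟨fun k hk => CSI.exists_mulBit_rep hI hk,
      fun D hD => D.rpow_le_size_of_mulBit hI (fun _ _ h => h) hD⟩⟩⟩
  simp only [Polynomial.eval_mul, Polynomial.eval_ofNat, Polynomial.eval_pow, Polynomial.eval_X]
  exact ⟨fun T hT => T.exists_rep hT, fun D hD => D.exists_rep hD, fun S hS => S.exists_rep hS⟩
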